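/- Let $P=\{z\in\mathbb R^n : Az=b,\ Bz\le d\}$ be a polyhedron given by integer matrices $A\in\mathbb Z^{m_A\times n}$, $B\in\mathbb Z^{m_B\times n}$ and real vectors $b,d$. A \emph{circuit} is a nonzero vector $g\in\ker A$ with coprime integer components such that the support of $Bg$ is inclusion-minimal among the supports of the vectors $Bz$, $z\in\ker A\setminus\{0\}$. For vertices $v,w$ of $P$, a \emph{circuit walk} of length $k$ from $v$ to $w$ is a sequence $v=y^{(0)},\dots,y^{(k)}=w$ in $\mathbb R^n$ with $y^{(i+1)}-y^{(i)}=\alpha_i g^i$ for circuits $g^i$ and reals $\alpha_i>0$ ($0\le i<k$). The walk * is an edge walk (e) if $y^{(i)}$ and $y^{(i+1)}$ are neighboring vertices in the graph of $P$ for all $i$; * is feasible (f) if every $y^{(i)}$ lies in $P$; * is maximal (m) if $y^{(i)}+\alpha g^i\notin P$ for all $i$ and all $\alpha>\alpha_i$; * is non-repetitive (r) if no circuit is used twice; * is non-backwards (b) if there are no $i,j$ with $g^i=-g^j$; * is sign-compatible (s) if $(Bg^i)_l(Bg^j)_l\ge 0$ and $(Bg^i)_l(B(w-v))_l\ge 0$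 for all $i,j,l$. For a string $R$ of these letters, let $\mathcal{CD}_R(v,w)\in\{0,1,2,\dots\}\cup\{\infty\}$ be the minimum length of a circuit walk from $v$ to $w$ that has all properties in $R$ ($\infty$ if there is none), and write $\mathcal{CD}$ if no property is required. Write $\mathcal{CD}_R\ge\mathcal{CD}_S$ if $\mathcal{CD}_R(v,w)\ge\mathcal{CD}_S(v,w)$ for all polyhedra as above (all $n,m_A,m_B,A,B,b,d$) and all pairs of vertices $v,w$. Write $\mathcal{CD}_R>_k\mathcal{CD}_S$ if $\mathcal{CD}_R\ge\mathcal{CD}_S$ and, in addition, there is a $k$-dimensional polytope in $\mathbb R^k$ with a pair of vertices $v,w$ for which both distances are finite and $\mathcal{CD}_R(v,w)>\mathcal{CD}_S(v,w)$. **Theorem.** The following relations hold: $$\mathcal{CD}_{efmb}>_2\mathcal{CD}_{efm},\quad \mathcal{CD}_{efmr}>_3\mathcal{CD}_{efm},$$ $$\mathcal{CD}_{efmb}>_2\mathcal{CD}_{fmb},\quad \mathcal{CD}_{efm}>_2\mathcal{CD}_{fm},\quad \mathcal{CD}_{efmr}>_2\mathcal{CD}_{fmr},$$ $$\mathcal{CD}_{fmb}>_2\mathcal{CD}_{fm},\quad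 \mathcal{CD}_{fmr}>_2\mathcal{CD}_{fm},$$ $$\mathcal{CD}_{fmb}>_2\mathcal{CD}_{fb},\quad \mathcal{CD}_{fm}>_2\mathcal{CD}_{f},\quad \mathcal{CD}_{fmr}>_2\mathcal{CD}_{fr},$$ $$\mathcal{CD}_{fb}\ge\mathcal{CD}_{f},\quad \mathcal{CD}_{fr}>_4\mathcal{CD}_{f},\quad \mathcal{CD}_{fbr}>_4\mathcal{CD}_{fb},\quad \mathcal{CD}_{fbr}\ge\mathcal{CD}_{fr},$$ $$\mathcal{CD}_{fs}>_3\mathcal{CD}_{fbr},\quad \mathcal{CD}_{f}>_3\mathcal{CD}.$$ -/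

import Mathlib

open Matrix

/-- The data `(A, B, b, d)` of a polyhedron `{z ∈ ℝⁿ : A z = b, B z ≤ d}` with integer matrices
`A`, `B` and real right-hand sides. Circuits depend on the matrices, so they are kept as data. -/
structure Polyhedron (n mA mB : ℕ) where
  A : Matrix (Fin mA) (Fin n) ℤ
  B : Matrix (Fin mB) (Fin n) ℤ
  b : Fin mA → ℝ
  d : Fin mB → ℝ

namespace Polyhedron

variable {n mA mB : ℕ} (P : Polyhedron n mA mB)

/-- The value `A z` for a real vector `z`. -/
def eqMap (z : Fin n → ℝ) : Fin mA → ℝ := P.A.map (Int.cast : ℤ → ℝ) *ᵥ z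

/-- The value `B z` for a real vector `z`. -/
def ineqMap (z : Fin n → ℝ) : Fin mB → ℝ := P.B.map (Int.cast : ℤ → ℝ) *ᵥ z

/-- The point set `{z : A z = b, B z ≤ d}`. -/
def carrier : Set (Fin n → ℝ) := {z | P.eqMap z = P.b ∧ P.ineqMap z ≤ P.d}

/-- The vertices (zero-dimensional faces) of the polyhedron. -/
def vertices : Set (Fin n → ℝ) := P.carrier.extremePoints ℝ

/-- Two distinct vertices are neighbors in the graph of the polyhedron if the segment joining
them is a face (an edge). -/
def Neighbors (u v : Fin n → ℝ) : Prop :=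
  u ∈ P.vertices ∧ v ∈ P.vertices ∧ u ≠ v ∧ IsExposed ℝ P.carrier (segment ℝ u v)

/-- An integer vector viewed as a real vector. -/
def toReal (g : Fin n → ℤ) : Fin n → ℝ := fun i => (g i : ℝ)

/-- The circuits associated with `A` and `B`: nonzero vectors `g` of `ker A` with coprime integer
components for which the support of `B g` is inclusion-minimal among the supports of the vectors
`B z` with `z ∈ ker A`, `z ≠ 0`. -/
def IsCircuit (g : Fin n → ℤ) : Prop :=
  P.eqMap (toReal g) = 0 ∧ g ≠ 0 ∧ Finset.univ.gcd g = 1 ∧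
    ∀ z : Fin n → ℝ, P.eqMap z = 0 → z ≠ 0 →
      Function.support (P.ineqMap z) ⊆ Function.support (P.ineqMap (toReal g)) →
      Function.support (P.ineqMap z) = Function.support (P.ineqMap (toReal g))

/-- Sign-compatibility of two vectors with respect to `B`. -/
def SignCompatible (x y : Fin n → ℝ) : Prop :=
  ∀ i, 0 ≤ P.ineqMap x i * P.ineqMap y i

/-- A circuit walk `v = y⁽⁰⁾, …, y⁽ᵏ⁾ = w` with `y⁽ⁱ⁺¹⁾ - y⁽ⁱ⁾ = αᵢ gⁱ`, `gⁱ` a circuit and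
`αᵢ > 0`. -/
structure CircuitWalk (v w : Fin n → ℝ) where
  length : ℕ
  pt : Fin (length + 1) → Fin n → ℝ
  dir : Fin length → Fin n → ℤ
  step : Fin length → ℝ
  pt_zero : pt 0 = v
  pt_last : pt (Fin.last length) = w
  isCircuit_dir : ∀ i, P.IsCircuit (dir i)
  step_pos : ∀ i, 0 < step i
  pt_succ : ∀ i : Fin length, pt i.succ - pt i.castSucc = step i • toReal (dir i)

end Polyhedron

/-- The names of the six restrictions that can be imposed on circuit walks: edge walk (`e`),
feasible (`f`), maximal (`m`), non-repetitive (`r`), non-backwards (`b`) and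
sign-compatible (`s`). -/
inductive Restriction where
  | e | f | m | r | b | s

namespace Polyhedron

variable {n mA mB : ℕ} {P : Polyhedron n mA mB} {v w : Fin n → ℝ}

/-- What each restriction demands of a circuit walk from `v` to `w`. -/
def CircuitWalk.Satisfies (W : P.CircuitWalk v w) : Restriction → Prop
  | .e => ∀ i : Fin W.length, P.Neighbors (W.pt i.castSucc) (W.pt i.succ)
  | .f => ∀ i, W.pt i ∈ P.carrier
  | .m => ∀ i : Fin W.length, ∀ a : ℝ, W.step i < a →
      W.pt i.castSucc + a • toReal (W.dir i) ∉ P.carrier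
  | .r => ∀ i j, i ≠ j → W.dir i ≠ W.dir j
  | .b => ∀ i j, W.dir i ≠ -W.dir j
  | .s => (∀ i j, P.SignCompatible (toReal (W.dir i)) (toReal (W.dir j))) ∧
      ∀ i, P.SignCompatible (toReal (W.dir i)) (w - v)

/-- The circuit distance from `v` to `w` with the set `R` of restrictions: the minimum length of a
circuit walk from `v` to `w` that satisfies all of them (`⊤` if there is no such walk). -/
noncomputable def CD (P : Polyhedron n mA mB) (R : Set Restriction) (v w : Fin n → ℝ) : ℕ∞ :=
  ⨅ (W : P.CircuitWalk v w) (_ : ∀ c ∈ R, W.Satisfies c), (W.length : ℕ∞)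

end Polyhedron

/-- `CD_R ≥ CD_S`: for every polyhedron and every pair of its vertices, the circuit distance with
restrictions `R` is an upper bound for the one with restrictions `S`. -/
def WeaklyBounds (R S : Set Restriction) : Prop :=
  ∀ (n mA mB : ℕ) (P : Polyhedron n mA mB), ∀ v ∈ P.vertices, ∀ w ∈ P.vertices,
    P.CD S v w ≤ P.CD R v w

/-- `CD_R > CD_S`: the inequality `CD_R ≥ CD_S` holds always, and there is a `k`-dimensional
polytope (a bounded polyhedron in `ℝᵏ` with nonempty interior) with a pair of vertices for which
both distances are finite and `CD_R` is strictly larger than `CD_S`. -/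
def StrictlyBounds (k : ℕ) (R S : Set Restriction) : Prop :=
  WeaklyBounds R S ∧
    ∃ (mA mB : ℕ) (P : Polyhedron k mA mB),
      Bornology.IsBounded P.carrier ∧ (interior P.carrier).Nonempty ∧
      ∃ v ∈ P.vertices, ∃ w ∈ P.vertices, P.CD S v w < P.CD R v w ∧ P.CD R v w < ⊤

/-!
The weak inequalities hold because every walk that satisfies `R` satisfies each subset of `R`. The
exception is `fs ≥ fbr`: a feasible sign-compatible walk need not be non-repetitive. Here
one merges all steps with the same direction into one. Sign-compatibility makes each partial sum of
the new steps stay in the polyhedron (`add_sum_mem_carrier`), since every row of `B` moves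
monotonically between its values at the two ends, and it excludes opposite directions, since `g` and
`-g` are sign-compatible only if `B g = 0`, which a polyhedron with a vertex does not allow.

The strict inequalities are witnessed by explicit polytopes `{z : B z ≤ d}` with integral data.
An upper bound is an explicit walk, whose properties reduce to decidable statements about rational
numbers (`CD_le_of_walkCriterion`). For lower bounds the circuits have to be known. At a pointed
polyhedron the rows of `B` orthogonal to a circuit `g` determine the line `ℝ g`
(`IsCircuit.exists_eq_smul`), so in dimensions two and three the circuits are the primitive vectors
orthogonal to one row or to two independent rows (`IsCircuit.mem_of_two`, `IsCircuit.mem_of_three`).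

If the walks in question are feasible and maximal, the current point and the direction determine
the next point. So there are only finitely many walks with a given number of steps, all of them
rational, and `noWalk` enumerates them; its soundness is `lt_length_of_noWalk`, and the kernel
evaluates it for a heptagon, a pentagon, a hexagon, an octagon, a decagon and a polytope with ten
facets in space.

Walks that are not maximal have real step lengths, and the remaining three lower bounds are proved
by hand. In a parallelepiped only three circuits are sign-compatible with the diagonal, and all
three are needed (`three_le_box_length`). In `{0 ≤ t ≤ 1, 0 ≤ x_i ≤ 2 - t}` a step either moves one
coordinate or changes `t` and moves some of the `x_i` by the opposite amount. To reach `(1, …, 1)`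
from `0` quickly one has to raise `t` first and then raise all `x_i` at the cost of `t`. With two
`x_i`, two steps suffice if the walk may leave the polytope and raise `t` to `2`
(`strictlyBounds_f_soft`). With three `x_i`, a feasible walk with three steps has to raise `t` from
`0` to `1` twice (`hfru_three_steps`), so it repeats a circuit.
-/

/-! ### Circuits, vertices and edges -/

namespace Polyhedron

section General

variable {n mA mB : ℕ} {P : Polyhedron n mA mB} {v w : Fin n → ℝ}

lemma eqMap_add (x y : Fin n → ℝ) : P.eqMap (x + y) = P.eqMap x + P.eqMap y :=
  Matrix.mulVec_add _ _ _

lemma eqMap_sub (x y : Fin n → ℝ) : P.eqMap (x - y) = P.eqMap x - P.eqMap y :=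
  Matrix.mulVec_sub _ _ _

lemma eqMap_smul (c : ℝ) (x : Fin n → ℝ) : P.eqMap (c • x) = c • P.eqMap x :=
  Matrix.mulVec_smul _ _ _

lemma ineqMap_add (x y : Fin n → ℝ) : P.ineqMap (x + y) = P.ineqMap x + P.ineqMap y :=
  Matrix.mulVec_add _ _ _

lemma ineqMap_sub (x y : Fin n → ℝ) : P.ineqMap (x - y) = P.ineqMap x - P.ineqMap y :=
  Matrix.mulVec_sub _ _ _

lemma ineqMap_smul (c : ℝ) (x : Fin n → ℝ) : P.ineqMap (c • x) = c • P.ineqMap x :=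
  Matrix.mulVec_smul _ _ _

lemma ineqMap_apply (x : Fin n → ℝ) (i : Fin mB) : P.ineqMap x i = ∑ j, (P.B i j : ℝ) * x j :=
  rfl

lemma continuous_ineqMap : Continuous P.ineqMap :=
  Continuous.matrix_mulVec continuous_const continuous_id

lemma toReal_ne_zero {g : Fin n → ℤ} (hg : g ≠ 0) : toReal g ≠ 0 := fun h =>
  hg (funext fun i => by simpa [toReal] using congrFun h i)

/-- A polyhedron with a vertex is pointed: `ker A ∩ ker B = 0`. -/
lemma eq_zero_of_mem_vertices (hv : v ∈ P.vertices) {z : Fin n → ℝ} (hA : P.eqMap z = 0)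
    (hB : P.ineqMap z = 0) : z = 0 := by
  have h1 : v + z ∈ P.carrier := ⟨by rw [eqMap_add, hA, add_zero]; exact hv.1.1,
    by rw [ineqMap_add, hB, add_zero]; exact hv.1.2⟩
  have h2 : v - z ∈ P.carrier := ⟨by rw [eqMap_sub, hA, sub_zero]; exact hv.1.1,
    by rw [ineqMap_sub, hB, sub_zero]; exact hv.1.2⟩
  have h3 : v ∈ openSegment ℝ (v + z) (v - z) :=
    ⟨1 / 2, 1 / 2, by norm_num, by norm_num, by norm_num, by ext i; simp; ring⟩
  simpa using hv.2 h1 h2 h3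

/-- The rows of `B` orthogonal to a circuit `g` determine the line `ℝ g` inside `ker A`: otherwise
a combination of `g` with another vector of their kernel would have smaller support. -/
lemma IsCircuit.exists_eq_smul (hv : v ∈ P.vertices) {g : Fin n → ℤ} (hg : P.IsCircuit g)
    {z : Fin n → ℝ} (hA : P.eqMap z = 0)
    (hB : ∀ i, P.ineqMap (toReal g) i = 0 → P.ineqMap z i = 0) : ∃ c : ℝ, z = c • toReal g := by
  obtain ⟨hgA, hg0, -, hmin⟩ := hg
  obtain ⟨l, hl⟩ : ∃ l, P.ineqMap (toReal g) l ≠ 0 := by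
    by_contra! h
    exact toReal_ne_zero hg0 (eq_zero_of_mem_vertices hv hgA (funext h))
  refine ⟨P.ineqMap z l / P.ineqMap (toReal g) l, ?_⟩
  by_contra hne
  set c := P.ineqMap z l / P.ineqMap (toReal g) l
  have key := hmin (z - c • toReal g) (by rw [eqMap_sub, eqMap_smul, hA, hgA]; simp)
    (sub_ne_zero.2 hne) (fun i hi hgi => hi (by
      rw [ineqMap_sub, ineqMap_smul]; simp [hB i hgi, hgi]))
  have : l ∈ Function.support (P.ineqMap (z - c • toReal g)) := key ▸ hl
  apply this
  rw [ineqMap_sub, ineqMap_smul]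
  simp [c, hl]

lemma isCircuit_of_forall_eq_smul {g : Fin n → ℤ} (hA : P.eqMap (toReal g) = 0) (h0 : g ≠ 0)
    (hgcd : Finset.univ.gcd g = 1)
    (h : ∀ z, P.eqMap z = 0 → (∀ i, P.ineqMap (toReal g) i = 0 → P.ineqMap z i = 0) →
      ∃ c : ℝ, z = c • toReal g) : P.IsCircuit g := by
  refine ⟨hA, h0, hgcd, fun z hz hz0 hsub => ?_⟩
  obtain ⟨c, rfl⟩ := h z hz fun i hi => by
    by_contra hne
    exact hsub hne hi
  have hc : c ≠ 0 := fun hc => hz0 (by simp [hc])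
  ext i
  simp [ineqMap_smul, hc]

/-- A feasible point at which the tight rows have trivial kernel is a vertex. -/
lemma mem_vertices_of_tight (hv : v ∈ P.carrier)
    (h : ∀ z, P.eqMap z = 0 → (∀ i, P.ineqMap v i = P.d i → P.ineqMap z i = 0) → z = 0) :
    v ∈ P.vertices := by
  refine ⟨hv, ?_⟩
  rintro x hx y hy ⟨a, b, ha, hb, hab, rfl⟩
  have hxv : x - (a • x + b • y) = 0 := by
    refine h _ ?_ fun i hi => ?_
    · rw [eqMap_sub, hx.1, hv.1, sub_self]
    · have h1 := hx.2 i
      have h2 := hy.2 i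
      rw [ineqMap_sub, Pi.sub_apply, hi]
      rw [ineqMap_add, ineqMap_smul, ineqMap_smul] at hi
      simp only [Pi.add_apply, Pi.smul_apply, smul_eq_mul] at hi
      have hbe : b = 1 - a := by linarith
      subst hbe
      nlinarith
  exact (sub_eq_zero.1 hxv)

/-- A segment inside the polyhedron is an edge if the rows tight along it determine its direction
and each endpoint has a tight row that blocks the line. -/
lemma neighbors_of_tight {g : Fin n → ℝ} {t : ℝ} (ht : 0 < t) (hv : v ∈ P.carrier)
    (hw : w ∈ P.carrier) (hvw : w = v + t • g)
    (hline : ∀ z, P.eqMap z = 0 →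
      (∀ i, P.ineqMap v i = P.d i → P.ineqMap g i = 0 → P.ineqMap z i = 0) → ∃ c : ℝ, z = c • g)
    (hbv : ∃ i, P.ineqMap v i = P.d i ∧ P.ineqMap g i < 0)
    (hbw : ∃ i, P.ineqMap w i = P.d i ∧ 0 < P.ineqMap g i) : P.Neighbors v w := by
  classical
  obtain ⟨k, hk, hkg⟩ := hbv
  obtain ⟨l, hl, hlg⟩ := hbw
  have hw_apply : ∀ i, P.ineqMap w i = P.ineqMap v i + t * P.ineqMap g i := fun i => by
    rw [hvw, ineqMap_add, ineqMap_smul]; rfl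
  refine ⟨mem_vertices_of_tight hv fun z hz h => ?_, mem_vertices_of_tight hw fun z hz h => ?_, ?_,
    ?_⟩
  · obtain ⟨c, rfl⟩ := hline z hz fun i hi _ => h i hi
    have := h k hk
    rw [ineqMap_smul, Pi.smul_apply, smul_eq_mul, mul_eq_zero] at this
    rcases this with h0 | h0
    · simp [h0]
    · exact absurd h0 hkg.ne
  · obtain ⟨c, rfl⟩ := hline z hz fun i hi hg => h i (by rw [hw_apply, hg, hi]; ring)
    have := h l hl
    rw [ineqMap_smul, Pi.smul_apply, smul_eq_mul, mul_eq_zero] at this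
    rcases this with h0 | h0
    · simp [h0]
    · exact absurd h0 hlg.ne'
  · rintro rfl
    have := hw_apply k
    nlinarith
  · intro _
    -- the sum of the tight rows supports exactly the points at which all of them are tight
    set S : Finset (Fin mB) := Finset.univ.filter fun i => P.ineqMap v i = P.d i ∧ P.ineqMap g i = 0
    let f : (Fin n → ℝ) →ₗ[ℝ] ℝ :=
      { toFun := fun x => ∑ i ∈ S, P.ineqMap x i
        map_add' := fun x y => by simp [ineqMap_add, Finset.sum_add_distrib]
        map_smul' := fun c x => by simp [ineqMap_smul, Finset.mul_sum] }
    have hf : ∀ x, f x = ∑ i ∈ S, P.ineqMap x i := fun _ => rfl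
    have hfv : f v = ∑ i ∈ S, P.d i := by
      rw [hf]
      exact Finset.sum_congr rfl fun i hi => (Finset.mem_filter.1 hi).2.1
    refine ⟨LinearMap.toContinuousLinearMap f, ?_⟩
    ext x
    simp only [LinearMap.coe_toContinuousLinearMap', Set.mem_ofPred_eq]
    constructor
    · rintro ⟨a, b, ha, hb, hab, rfl⟩
      have hxe : a • v + b • w = v + (b * t) • g := by
        rw [hvw, smul_add, ← add_assoc, ← add_smul, hab, one_smul, smul_smul]
      refine ⟨⟨?_, ?_⟩, fun y hy => ?_⟩
      · rw [eqMap_add, eqMap_smul, eqMap_smul, hv.1, hw.1, ← add_smul, hab, one_smul]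
      · intro i
        have h1 := hv.2 i
        have h2 := hw.2 i
        rw [ineqMap_add, ineqMap_smul, ineqMap_smul]
        simp only [Pi.add_apply, Pi.smul_apply, smul_eq_mul]
        obtain rfl : a = 1 - b := by linarith
        nlinarith
      · have : f (a • v + b • w) = f v := by
          rw [hxe, hf, hf]
          refine Finset.sum_congr rfl fun i hi => ?_
          rw [ineqMap_add, ineqMap_smul, Pi.add_apply, Pi.smul_apply,
            (Finset.mem_filter.1 hi).2.2, smul_zero, add_zero]
        rw [this, hfv, hf]
        exact Finset.sum_le_sum fun i _ => hy.2 i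
    · rintro ⟨hx, hmax⟩
      have h1 : ∑ i ∈ S, P.ineqMap x i = ∑ i ∈ S, P.d i :=
        le_antisymm (Finset.sum_le_sum fun i _ => hx.2 i) (hfv ▸ hmax v hv)
      have h2 := (Finset.sum_eq_sum_iff_of_le fun i _ => hx.2 i).1 h1
      obtain ⟨c, hc⟩ := hline (x - v) (by rw [eqMap_sub, hx.1, hv.1, sub_self]) fun i hi hg => by
        rw [ineqMap_sub, Pi.sub_apply, hi, h2 i (Finset.mem_filter.2 ⟨Finset.mem_univ _, hi, hg⟩),
          sub_self]
      have hx' : x = v + c • g := by rw [← hc]; abel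
      have hxa : ∀ i, P.ineqMap x i = P.ineqMap v i + c * P.ineqMap g i := fun i => by
        rw [hx', ineqMap_add, ineqMap_smul]; rfl
      have hc0 : 0 ≤ c := by
        have h3 := hx.2 k
        rw [hxa] at h3
        nlinarith
      have hct : c ≤ t := by
        have h3 := hx.2 l
        have h4 := hw_apply l
        rw [hxa] at h3
        by_contra! hlt
        nlinarith
      refine ⟨1 - c / t, c / t, ?_, by positivity, by ring, ?_⟩
      · rw [sub_nonneg, div_le_one ht]; exact hct
      · rw [hvw, hx', smul_add, ← add_assoc, ← add_smul, smul_smul, div_mul_cancel₀ _ ht.ne']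
        simp

/-- The rows that are tight along an edge determine its direction. -/
lemma Neighbors.exists_eq_smul (h : P.Neighbors v w) {z : Fin n → ℝ} (hz : P.eqMap z = 0)
    (hB : ∀ i, P.ineqMap v i = P.d i → P.ineqMap w i = P.d i → P.ineqMap z i = 0) :
    ∃ c : ℝ, z = c • (w - v) := by
  obtain ⟨hv, hw, -, hexp⟩ := h
  have hev : ∀ᶠ ε : ℝ in nhds 0, ∀ i, ¬ (P.ineqMap v i = P.d i ∧ P.ineqMap w i = P.d i) →
      ε * |P.ineqMap z i| < P.d i - (P.ineqMap v i + P.ineqMap w i) / 2 := by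
    rw [Filter.eventually_all]
    intro i
    by_cases hi : P.ineqMap v i = P.d i ∧ P.ineqMap w i = P.d i
    · simp [hi]
    · have hlt : 0 * |P.ineqMap z i| < P.d i - (P.ineqMap v i + P.ineqMap w i) / 2 := by
        have h1 := hv.1.2 i
        have h2 := hw.1.2 i
        rcases h1.lt_or_eq with h1 | h1
        · linarith
        · have := lt_of_le_of_ne h2 fun h => hi ⟨h1, h⟩
          linarith
      have hc : Continuous fun ε : ℝ => ε * |P.ineqMap z i| := by fun_prop
      filter_upwards [hc.continuousAt.eventually_lt continuousAt_const hlt] with ε hε _ using hε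
  obtain ⟨ε, hε, hε0⟩ := ((hev.filter_mono nhdsWithin_le_nhds).and
    (self_mem_nhdsWithin : Set.Ioi (0 : ℝ) ∈ nhdsWithin 0 (Set.Ioi 0))).exists
  set c : Fin n → ℝ := (1 / 2 : ℝ) • v + (1 / 2 : ℝ) • w with hc
  have hmem : ∀ s : ℝ, |s| = ε → c + s • z ∈ P.carrier := by
    intro s hs
    refine ⟨?_, fun i => ?_⟩
    · rw [hc, eqMap_add, eqMap_add, eqMap_smul, eqMap_smul, eqMap_smul, hz, hv.1.1, hw.1.1,
        smul_zero, add_zero, ← add_smul]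
      norm_num
    · rw [hc, ineqMap_add, ineqMap_add, ineqMap_smul, ineqMap_smul, ineqMap_smul]
      simp only [Pi.add_apply, Pi.smul_apply, smul_eq_mul]
      by_cases hi : P.ineqMap v i = P.d i ∧ P.ineqMap w i = P.d i
      · rw [hB i hi.1 hi.2, hi.1, hi.2]
        linarith
      · have h1 := hε i hi
        have h2 : s * P.ineqMap z i ≤ ε * |P.ineqMap z i| := by
          rw [← hs, ← abs_mul]
          exact le_abs_self _
        linarith
  have hcs : c ∈ segment ℝ v w := ⟨1 / 2, 1 / 2, by norm_num, by norm_num, by norm_num, rfl⟩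
  have hin : c + ε • z ∈ segment ℝ v w := by
    refine hexp.isExtreme.2 (hmem ε (abs_of_pos hε0))
      (hmem (-ε) (by rw [abs_neg, abs_of_pos hε0])) hcs
      ⟨1 / 2, 1 / 2, by norm_num, by norm_num, by norm_num, ?_⟩
    ext i
    simp
    ring
  obtain ⟨a, b, ha, hb, hab, he⟩ := hin
  refine ⟨ε⁻¹ * (b - 1 / 2), ?_⟩
  obtain rfl : a = 1 - b := by linarith
  have : ε • z = (b - 1 / 2) • (w - v) := by
    ext i
    have := congrFun he i
    simp only [hc, Pi.add_apply, Pi.smul_apply, smul_eq_mul, Pi.sub_apply] at this ⊢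
    linarith
  rw [mul_smul, ← this, smul_smul, inv_mul_cancel₀ hε0.ne', one_smul]

lemma CD_le (W : P.CircuitWalk v w) {R : Set Restriction} (h : ∀ c ∈ R, W.Satisfies c) :
    P.CD R v w ≤ W.length :=
  iInf₂_le W h

lemma le_CD {R : Set Restriction} {k : ℕ}
    (h : ∀ W : P.CircuitWalk v w, (∀ c ∈ R, W.Satisfies c) → k ≤ W.length) :
    (k : ℕ∞) ≤ P.CD R v w :=
  le_iInf₂ fun W hW => by exact_mod_cast h W hW

lemma CD_mono {R S : Set Restriction} (h : S ⊆ R) : P.CD S v w ≤ P.CD R v w :=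
  le_iInf₂ fun W hW => CD_le W fun c hc => hW c (h hc)

end General

end Polyhedron

lemma weaklyBounds_of_subset {R S : Set Restriction} (h : S ⊆ R) : WeaklyBounds R S :=
  fun _ _ _ _ _ _ _ _ => Polyhedron.CD_mono h

/-! ### Merging sign-compatible steps -/

namespace Polyhedron

section SignCompatible

variable {n mA mB : ℕ} {P : Polyhedron n mA mB} {v w : Fin n → ℝ}

lemma sum_fin_succ_sub_castSucc {E : Type*} [AddCommGroup E] {k : ℕ} (f : Fin (k + 1) → E) :
    ∑ i : Fin k, (f i.succ - f i.castSucc) = f (Fin.last k) - f 0 := by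
  induction k with
  | zero => simp
  | succ k ih =>
    rw [Fin.sum_univ_castSucc]
    have := ih fun i => f i.castSucc
    simp only [Fin.succ_castSucc, Fin.castSucc_zero] at this ⊢
    rw [this, Fin.succ_last]
    abel

lemma CircuitWalk.sum_step_smul (W : P.CircuitWalk v w) :
    ∑ i, W.step i • toReal (W.dir i) = w - v := by
  have h := sum_fin_succ_sub_castSucc W.pt
  rw [W.pt_last, W.pt_zero] at h
  rw [← h]
  exact Finset.sum_congr rfl fun i _ => (W.pt_succ i).symm

/-- Moving from `v` along part of a family of sign-compatible vectors with total `w - v` does not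
leave the polyhedron: in each row the change has the sign of the total change. -/
lemma add_sum_mem_carrier {ι : Type*} [DecidableEq ι] (s t : Finset ι) (hst : s ⊆ t)
    (u : ι → Fin n → ℝ) (hv : v ∈ P.carrier) (hw : v + ∑ i ∈ t, u i ∈ P.carrier)
    (hA : ∀ i ∈ t, P.eqMap (u i) = 0) (hu : ∀ i ∈ t, ∀ j ∈ t, P.SignCompatible (u i) (u j)) :
    v + ∑ i ∈ s, u i ∈ P.carrier := by
  have heq : ∀ r : Finset ι, P.ineqMap (∑ i ∈ r, u i) = ∑ i ∈ r, P.ineqMap (u i) := fun r =>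
    map_sum (Matrix.mulVecLin _) u r
  have heqA : ∀ r : Finset ι, P.eqMap (∑ i ∈ r, u i) = ∑ i ∈ r, P.eqMap (u i) := fun r =>
    map_sum (Matrix.mulVecLin _) u r
  refine ⟨?_, fun l => ?_⟩
  · rw [eqMap_add, heqA, Finset.sum_eq_zero fun i hi => hA i (hst hi), add_zero, hv.1]
  · have h1 := hv.2 l
    have h2 := hw.2 l
    rw [ineqMap_add, heq, Pi.add_apply, Finset.sum_apply] at h2 ⊢
    by_cases h : ∀ i ∈ t, 0 ≤ P.ineqMap (u i) l
    · have : ∑ i ∈ s, P.ineqMap (u i) l ≤ ∑ i ∈ t, P.ineqMap (u i) l :=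
        Finset.sum_le_sum_of_subset_of_nonneg hst fun i hi _ => h i hi
      linarith
    · push Not at h
      obtain ⟨j, hj, hjl⟩ := h
      have : ∑ i ∈ s, P.ineqMap (u i) l ≤ 0 := Finset.sum_nonpos fun i hi => by
        have := hu i (hst hi) j hj l
        by_contra! hpos
        nlinarith
      linarith

/-- A sign-compatible walk is never shortened by the other conditions on feasible walks: its equal
directions can be merged into one step each, in any order, and it cannot contain `g` and `-g`. -/
theorem weaklyBounds_signCompatible : WeaklyBounds {.f, .s} {.f, .b, .r} := by
  classical
  intro n mA mB P v hv w hw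
  refine le_iInf₂ fun W hW => ?_
  have hs : W.Satisfies .s := hW .s (by simp)
  set D : Finset (Fin n → ℤ) := Finset.univ.image W.dir with hD
  let a : (Fin n → ℤ) → ℝ := fun g => ∑ i with W.dir i = g, W.step i
  have ha : ∀ g ∈ D, 0 < a g := by
    intro g hg
    obtain ⟨i, -, rfl⟩ := Finset.mem_image.1 hg
    exact Finset.sum_pos (fun j _ => W.step_pos j) ⟨i, by simp⟩
  have hcirc : ∀ g ∈ D, P.IsCircuit g := by
    intro g hg
    obtain ⟨i, -, rfl⟩ := Finset.mem_image.1 hg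
    exact W.isCircuit_dir i
  have hcomp : ∀ g ∈ D, ∀ h ∈ D, P.SignCompatible (toReal g) (toReal h) := by
    intro g hg h hh
    obtain ⟨i, -, rfl⟩ := Finset.mem_image.1 hg
    obtain ⟨j, -, rfl⟩ := Finset.mem_image.1 hh
    exact hs.1 i j
  have htotal : ∑ g ∈ D, a g • toReal g = w - v := by
    rw [← W.sum_step_smul, ← Finset.sum_fiberwise_of_maps_to (g := W.dir) (t := D)
      (fun i _ => Finset.mem_image_of_mem _ (Finset.mem_univ i))]
    refine Finset.sum_congr rfl fun g _ => ?_
    rw [Finset.sum_smul]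
    refine Finset.sum_congr rfl fun i hi => ?_
    rw [(Finset.mem_filter.1 hi).2]
  let e : Fin D.card ≃ D := D.equivFin.symm
  let u : Fin D.card → Fin n → ℝ := fun j => a (e j) • toReal (e j : Fin n → ℤ)
  have hu : ∑ j, u j = w - v := by
    rw [← htotal, ← Finset.sum_coe_sort D, ← Equiv.sum_comp e]
  let W' : P.CircuitWalk v w :=
    { length := D.card
      pt := fun i => v + ∑ j with j.castSucc < i, u j
      dir := fun j => e j
      step := fun j => a (e j)
      pt_zero := by simp
      pt_last := by
        have : ∀ j : Fin D.card, j.castSucc < Fin.last _ := Fin.castSucc_lt_last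
        simp [this, hu]
      isCircuit_dir := fun j => hcirc _ (e j).2
      step_pos := fun j => ha _ (e j).2
      pt_succ := fun i => by
        have : (Finset.univ.filter fun j : Fin D.card => j.castSucc < i.succ) =
            insert i (Finset.univ.filter fun j : Fin D.card => j.castSucc < i.castSucc) := by
          ext j
          simp only [Finset.mem_filter, Finset.mem_insert, Finset.mem_univ, true_and, Fin.lt_def,
            Fin.ext_iff, Fin.val_succ, Fin.val_castSucc]
          omega
        rw [this, Finset.sum_insert (by simp)]
        simp only [u]
        abel }
  have hlen : W'.length ≤ W.length := by
    simpa using Finset.card_image_le (s := Finset.univ) (f := W.dir)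
  refine (CD_le W' fun c hc => ?_).trans (by exact_mod_cast hlen)
  rcases hc with rfl | rfl | rfl
  · intro i
    refine add_sum_mem_carrier _ Finset.univ (Finset.subset_univ _) u hv.1 ?_ ?_ ?_
    · rw [hu, add_sub_cancel]
      exact hw.1
    · intro j _
      simp only [u]
      rw [eqMap_smul, (hcirc _ (e j).2).1, smul_zero]
    · intro i _ j _ l
      simp only [u]
      rw [ineqMap_smul, ineqMap_smul, Pi.smul_apply, Pi.smul_apply, smul_eq_mul, smul_eq_mul,
        mul_mul_mul_comm]
      exact mul_nonneg (mul_pos (ha _ (e i).2) (ha _ (e j).2)).le (hcomp _ (e i).2 _ (e j).2 l)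
  · intro i j hij
    have h1 : toReal (W'.dir i) = -toReal (W'.dir j) := by
      rw [hij]
      ext l
      simp [toReal]
    have hc := hcirc _ (e j).2
    refine toReal_ne_zero hc.2.1 (eq_zero_of_mem_vertices hv hc.1 (funext fun l => ?_))
    have h2 := hcomp _ (e i).2 _ (e j).2 l
    change 0 ≤ P.ineqMap (toReal (W'.dir i)) l * _ at h2
    rw [h1, ← neg_one_smul ℝ, ineqMap_smul, Pi.smul_apply, smul_eq_mul] at h2
    change 0 ≤ -1 * P.ineqMap (toReal (e j : Fin n → ℤ)) l * _ at h2
    have h3 : P.ineqMap (toReal (e j : Fin n → ℤ)) l *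
        P.ineqMap (toReal (e j : Fin n → ℤ)) l ≤ 0 := by
      linarith
    simpa using le_antisymm h3 (mul_self_nonneg _)
  · intro i j hij h
    exact hij (e.injective (Subtype.ext h))

end SignCompatible

end Polyhedron

/-! ### Polyhedra with integral data -/

namespace Polyhedron

section Rational

variable {n m : ℕ}

/-- The polyhedron `{z : B z ≤ d}` without equations and with an integral right-hand side. -/
def ofIneq (B : Matrix (Fin m) (Fin n) ℤ) (d : Fin m → ℤ) : Polyhedron n 0 m :=
  ⟨0, B, 0, fun i => (d i : ℝ)⟩

/-- A rational point viewed as a real point. -/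
def castPt (p : Fin n → ℚ) : Fin n → ℝ := fun j => (p j : ℝ)

/-- The value of row `i` of `B` at a rational point. -/
def rowVal (B : Matrix (Fin m) (Fin n) ℤ) (i : Fin m) (p : Fin n → ℚ) : ℚ :=
  ∑ j, (B i j : ℚ) * p j

/-- The value of row `i` of `B` at an integer direction. -/
def rowDir (B : Matrix (Fin m) (Fin n) ℤ) (i : Fin m) (g : Fin n → ℤ) : ℤ :=
  ∑ j, B i j * g j

variable {B : Matrix (Fin m) (Fin n) ℤ} {d : Fin m → ℤ}

lemma castPt_injective : Function.Injective (castPt (n := n)) := fun p q h =>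
  funext fun j => by simpa [castPt] using congrFun h j

lemma eqMap_ofIneq (z : Fin n → ℝ) (c : Fin 0 → ℝ) : (ofIneq B d).eqMap z = c :=
  Subsingleton.elim _ _

lemma ineqMap_castPt (p : Fin n → ℚ) (i : Fin m) :
    (ofIneq B d).ineqMap (castPt p) i = (rowVal B i p : ℝ) := by
  simp [ineqMap_apply, rowVal, castPt, ofIneq]

lemma ineqMap_toReal (g : Fin n → ℤ) (i : Fin m) :
    (ofIneq B d).ineqMap (toReal g) i = (rowDir B i g : ℝ) := by
  simp [ineqMap_apply, rowDir, toReal, ofIneq]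

lemma castPt_mem_carrier {p : Fin n → ℚ} :
    castPt p ∈ (ofIneq B d).carrier ↔ ∀ i, rowVal B i p ≤ d i := by
  refine ⟨fun h i => ?_, fun h => ⟨eqMap_ofIneq _ _, fun i => ?_⟩⟩
  · have := h.2 i
    rw [ineqMap_castPt] at this
    exact (Rat.cast_le (K := ℝ)).1 (by simpa [ofIneq] using this)
  · rw [ineqMap_castPt]
    simpa [ofIneq] using (Rat.cast_le (K := ℝ)).2 (h i)

lemma ineqMap_castPt_eq_iff {p : Fin n → ℚ} {i : Fin m} :
    (ofIneq B d).ineqMap (castPt p) i = (ofIneq B d).d i ↔ rowVal B i p = d i := by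
  rw [ineqMap_castPt, ← Rat.cast_inj (α := ℝ)]
  simp [ofIneq]

/-- The rows in `S` determine the line spanned by `g`: every common zero is a multiple of `g`. -/
def DeterminesLine (B : Matrix (Fin m) (Fin n) ℤ) (S : Fin m → Prop) (g : Fin n → ℤ) : Prop :=
  ∀ z : Fin n → ℝ, (∀ i, S i → ∑ j, (B i j : ℝ) * z j = 0) → ∃ c : ℝ, z = c • toReal g

lemma DeterminesLine.mono {S T : Fin m → Prop} {g : Fin n → ℤ} (h : DeterminesLine B S g)
    (hST : ∀ i, S i → T i) : DeterminesLine B T g :=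
  fun z hz => h z fun i hi => hz i (hST i hi)

lemma ne_zero_of_gcd_eq_one {g : Fin n → ℤ} (hg : Finset.univ.gcd g = 1) : g ≠ 0 := by
  rintro rfl
  exact zero_ne_one ((Finset.gcd_eq_zero_iff.2 fun _ _ => rfl).symm.trans hg)

lemma isCircuit_of_determinesLine {g : Fin n → ℤ} (hgcd : Finset.univ.gcd g = 1)
    (h : DeterminesLine B (fun i => rowDir B i g = 0) g) : (ofIneq B d).IsCircuit g :=
  isCircuit_of_forall_eq_smul (eqMap_ofIneq _ _) (ne_zero_of_gcd_eq_one hgcd) hgcd fun z _ hz =>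
    h z fun i hi => hz i (by rw [ineqMap_toReal, hi, Int.cast_zero])

/-- Parallel primitive integer vectors agree up to sign. -/
lemma eq_or_eq_neg_of_parallel {g h : Fin n → ℤ} (hg : Finset.univ.gcd g = 1)
    (hh : Finset.univ.gcd h = 1) {c : ℝ} (hc : toReal g = c • toReal h) : g = h ∨ g = -h := by
  obtain ⟨k, hk⟩ : ∃ k, h k ≠ 0 := Function.ne_iff.1 (ne_zero_of_gcd_eq_one hh)
  have hpar : ∀ i, h k * g i = g k * h i := fun i => by
    have h1 := congrFun hc i
    have h2 := congrFun hc k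
    simp only [toReal, Pi.smul_apply, smul_eq_mul] at h1 h2
    have : (h k : ℝ) * g i = g k * h i := by rw [h1, h2]; ring
    exact_mod_cast this
  have h1 : Finset.univ.gcd (fun i => h k * g i) = Finset.univ.gcd (fun i => g k * h i) := by
    simp only [hpar]
  rw [Finset.gcd_mul_left, Finset.gcd_mul_left, hg, hh, mul_one, mul_one] at h1
  rcases (abs_eq_abs.1 (by simpa [← Int.abs_eq_normalize] using h1) : h k = g k ∨ h k = -g k)
    with he | he
  · left
    funext i
    have := hpar i
    rw [← he] at this
    exact mul_left_cancel₀ hk this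
  · right
    funext i
    have := hpar i
    have hgk : g k = -h k := by omega
    rw [hgk, neg_mul, ← mul_neg] at this
    exact mul_left_cancel₀ hk this

/-! ### Walks given by rational data -/

/-- The circuit walk with prescribed rational points and steps. -/
def walkOfData {k : ℕ} (pt : Fin (k + 1) → Fin n → ℚ) (dir : Fin k → Fin n → ℤ) (step : Fin k → ℚ)
    (hc : ∀ i, (ofIneq B d).IsCircuit (dir i)) (hs : ∀ i, 0 < step i)
    (hp : ∀ i j, pt i.succ j = pt i.castSucc j + step i * dir i j) :
    (ofIneq B d).CircuitWalk (castPt (pt 0)) (castPt (pt (Fin.last k))) where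
  length := k
  pt := fun i => castPt (pt i)
  dir := dir
  step := fun i => (step i : ℝ)
  pt_zero := rfl
  pt_last := rfl
  isCircuit_dir := hc
  step_pos := fun i => by exact_mod_cast hs i
  pt_succ := fun i => by
    funext j
    simp [castPt, toReal, hp]

section WalkOfData

variable {k : ℕ} {pt : Fin (k + 1) → Fin n → ℚ} {dir : Fin k → Fin n → ℤ} {step : Fin k → ℚ}
  (hc : ∀ i, (ofIneq B d).IsCircuit (dir i)) (hs : ∀ i, 0 < step i)
  (hp : ∀ i j, pt i.succ j = pt i.castSucc j + step i * dir i j)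

lemma walkOfData_feasible (h : ∀ i r, rowVal B r (pt i) ≤ d r) :
    (walkOfData pt dir step hc hs hp).Satisfies .f := fun i => castPt_mem_carrier.2 (h i)

lemma walkOfData_maximal
    (h : ∀ i : Fin k, ∃ r, 0 < rowDir B r (dir i) ∧ rowVal B r (pt i.succ) = d r) :
    (walkOfData pt dir step hc hs hp).Satisfies .m := by
  intro i a ha hmem
  obtain ⟨r, hr, htight⟩ := h i
  have h1 := hmem.2 r
  have h2 := (walkOfData pt dir step hc hs hp).pt_succ i
  have h3 : (ofIneq B d).ineqMap (castPt (pt i.succ)) r = d r := ineqMap_castPt_eq_iff.2 htight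
  have h4 : (walkOfData pt dir step hc hs hp).pt i.castSucc =
      castPt (pt i.succ) - (step i : ℝ) • toReal (dir i) := by
    rw [eq_sub_iff_add_eq, add_comm, ← eq_sub_iff_add_eq]
    exact h2.symm
  rw [h4, ineqMap_add, ineqMap_sub, ineqMap_smul, ineqMap_smul] at h1
  simp only [Pi.add_apply, Pi.sub_apply, Pi.smul_apply, smul_eq_mul] at h1
  rw [h3] at h1
  change _ - _ * (ofIneq B d).ineqMap (toReal (dir i)) r +
    a * (ofIneq B d).ineqMap (toReal (dir i)) r ≤ (d r : ℝ) at h1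
  rw [ineqMap_toReal] at h1
  have hr' : (0 : ℝ) < rowDir B r (dir i) := by exact_mod_cast hr
  have ha' : (step i : ℝ) < a := ha
  nlinarith

lemma walkOfData_edge (hf : ∀ i r, rowVal B r (pt i) ≤ d r)
    (hline : ∀ i : Fin k, DeterminesLine B
      (fun r => rowVal B r (pt i.castSucc) = d r ∧ rowDir B r (dir i) = 0) (dir i))
    (hstart : ∀ i : Fin k, ∃ r, rowDir B r (dir i) < 0 ∧ rowVal B r (pt i.castSucc) = d r)
    (hend : ∀ i : Fin k, ∃ r, 0 < rowDir B r (dir i) ∧ rowVal B r (pt i.succ) = d r) :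
    (walkOfData pt dir step hc hs hp).Satisfies .e := by
  intro i
  obtain ⟨r, hr, hrt⟩ := hstart i
  obtain ⟨s, hs', hst⟩ := hend i
  refine neighbors_of_tight (g := toReal (dir i)) (t := (step i : ℝ)) (by exact_mod_cast hs i)
    (castPt_mem_carrier.2 (hf _)) (castPt_mem_carrier.2 (hf _)) ?_ (fun z _ hz => ?_)
    ⟨r, ineqMap_castPt_eq_iff.2 hrt, ?_⟩ ⟨s, ineqMap_castPt_eq_iff.2 hst, ?_⟩
  · exact eq_add_of_sub_eq' ((walkOfData pt dir step hc hs hp).pt_succ i)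
  · exact hline i z fun l hl => hz l (ineqMap_castPt_eq_iff.2 hl.1)
      (by rw [ineqMap_toReal, hl.2, Int.cast_zero])
  · rw [ineqMap_toReal]
    exact_mod_cast hr
  · rw [ineqMap_toReal]
    exact_mod_cast hs'

end WalkOfData

/-! ### Enumeration of maximal walks -/

/-- The number of rows that are tight at `p` and orthogonal to `g`. -/
def tightCount (B : Matrix (Fin m) (Fin n) ℤ) (d : Fin m → ℤ) (p : Fin n → ℚ) (g : Fin n → ℤ) : ℕ :=
  (Finset.univ.filter fun i => rowVal B i p = d i ∧ rowDir B i g = 0).card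

/-- Whether a step from `p` in direction `g` is ruled out at once: `e` demands that `g` is the
direction of an edge at `p`, `b` and `r` that `-g` and `g` do not occur in the list `used` of the
directions of earlier steps. -/
def isExcluded (B : Matrix (Fin m) (Fin n) ℤ) (d : Fin m → ℤ) (e b r : Bool)
    (used : List (Fin n → ℤ)) (p : Fin n → ℚ) (g : Fin n → ℤ) : Bool :=
  (e && decide (tightCount B d p g < n - 1)) || (b && used.any fun h => decide (g = -h)) ||
    (r && used.any fun h => decide (g = h))

/-- A search through the feasible maximal walks with directions in `L` that start at `p` and have
at most `k` steps; it returns `true` if none of them ends at `w`. The flags `e`, `b`, `r` restrict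
the search to walks along edges, to non-backwards walks and to non-repetitive walks. A maximal step
from `p` in direction `g` ends on the hyperplane of some row `i` that increases along `g`; this
determines its length. For the last step it is enough to look at the direction of `w - p`. -/
def noWalk (B : Matrix (Fin m) (Fin n) ℤ) (d : Fin m → ℤ) (L : List (Fin n → ℤ)) (e b r : Bool)
    (w : Fin n → ℚ) : ℕ → List (Fin n → ℤ) → (Fin n → ℚ) → Bool
  | 0, _, p => decide (p ≠ w)
  | 1, used, p => decide (p ≠ w) && L.all fun g =>
      !(decide (0 < ∑ j, (w j - p j) * g j) &&
        decide (∀ i j, i < j → (w i - p i) * g j = (w j - p j) * g i)) ||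
      isExcluded B d e b r used p g
  | k + 2, used, p => decide (p ≠ w) && L.all fun g =>
      isExcluded B d e b r used p g ||
      (List.finRange m).all fun i => decide (rowDir B i g ≤ 0) ||
        let t := ((d i : ℚ) - rowVal B i p) / rowDir B i g
        decide (t ≤ 0) ||
          let q := fun j => p j + t * g j
          decide (¬ ∀ l, rowVal B l q ≤ d l) || noWalk B d L e b r w (k + 1) (g :: used) q

/-- At least `n - 1` rows are tight along an edge. -/
lemma le_tightCount {p q : Fin n → ℚ} {g : Fin n → ℤ} {t : ℝ}
    (h : (ofIneq B d).Neighbors (castPt p) (castPt q))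
    (ht : castPt q - castPt p = t • toReal g) : n - 1 ≤ tightCount B d p g := by
  classical
  set S := Finset.univ.filter fun i => rowVal B i p = d i ∧ rowDir B i g = 0 with hS
  have ht0 : t ≠ 0 := by
    rintro rfl
    rw [zero_smul, sub_eq_zero] at ht
    exact h.2.2.1 ht.symm
  let f : (Fin n → ℝ) →ₗ[ℝ] (S → ℝ) :=
    { toFun := fun z i => (ofIneq B d).ineqMap z i
      map_add' := fun x y => by ext; simp [ineqMap_add]
      map_smul' := fun c x => by ext; simp [ineqMap_smul] }
  have hker : Module.finrank ℝ (LinearMap.ker f) ≤ 1 := by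
    have hgker : toReal g ∈ LinearMap.ker f := by
      rw [LinearMap.mem_ker]
      ext i
      change (ofIneq B d).ineqMap (toReal g) i = 0
      rw [ineqMap_toReal, (Finset.mem_filter.1 i.2).2.2, Int.cast_zero]
    refine finrank_le_one (⟨toReal g, hgker⟩ : LinearMap.ker f) fun z => ?_
    obtain ⟨c, hc⟩ := h.exists_eq_smul (z := z) (eqMap_ofIneq _ _) fun i hi hi' => by
      have hi2 : rowDir B i g = 0 := by
        have h1 := congrFun (congrArg (ofIneq B d).ineqMap ht) i
        rw [ineqMap_sub, ineqMap_smul, Pi.sub_apply, Pi.smul_apply, hi, hi', sub_self,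
          ineqMap_toReal, smul_eq_mul] at h1
        have := (mul_eq_zero.1 h1.symm).resolve_left ht0
        exact_mod_cast this
      exact congrFun z.2 (⟨i, Finset.mem_filter.2
        ⟨Finset.mem_univ _, ineqMap_castPt_eq_iff.1 hi, hi2⟩⟩ : S)
    refine ⟨c * t, Subtype.ext ?_⟩
    change (c * t) • toReal g = (z : Fin n → ℝ)
    rw [hc, ht, smul_smul]
  have h1 := LinearMap.finrank_range_add_finrank_ker f
  have h2 := Submodule.finrank_le (LinearMap.range f)
  rw [Module.finrank_fintype_fun_eq_card, Fintype.card_coe] at h2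
  rw [Module.finrank_fintype_fun_eq_card, Fintype.card_fin] at h1
  change n - 1 ≤ S.card
  omega

/-- A feasible maximal step ends on a row that increases along it. -/
lemma exists_blocking_row {x g : Fin n → ℝ} {t : ℝ} (h1 : x + t • g ∈ (ofIneq B d).carrier)
    (h2 : ∀ a, t < a → x + a • g ∉ (ofIneq B d).carrier) :
    ∃ i, 0 < (ofIneq B d).ineqMap g i ∧ (ofIneq B d).ineqMap (x + t • g) i = d i := by
  by_contra! hno
  have hev : ∀ᶠ a : ℝ in nhdsWithin t (Set.Ioi t), ∀ i,
      (ofIneq B d).ineqMap (x + a • g) i ≤ d i := by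
    rw [Filter.eventually_all]
    intro i
    have hle : (ofIneq B d).ineqMap (x + t • g) i ≤ d i := h1.2 i
    rcases le_or_gt ((ofIneq B d).ineqMap g i) 0 with hg | hg
    · filter_upwards [self_mem_nhdsWithin] with a ha
      have ha' : t < a := ha
      rw [ineqMap_add, ineqMap_smul] at hle ⊢
      simp only [Pi.add_apply, Pi.smul_apply, smul_eq_mul] at hle ⊢
      nlinarith
    · have hlt := lt_of_le_of_ne hle (hno i hg)
      have hc : Continuous fun a : ℝ => (ofIneq B d).ineqMap (x + a • g) i :=
        (continuous_apply i).comp (continuous_ineqMap.comp (by fun_prop))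
      filter_upwards [(hc.continuousAt.eventually_lt continuousAt_const hlt).filter_mono
        nhdsWithin_le_nhds] with a ha using ha.le
  obtain ⟨a, ha, hta⟩ := (hev.and self_mem_nhdsWithin).exists
  exact h2 a hta ⟨eqMap_ofIneq _ _, ha⟩

lemma isExcluded_eq_false {e b r : Bool} {v w : Fin n → ℝ} (W : (ofIneq B d).CircuitWalk v w)
    (he : e = true → W.Satisfies .e) (hb : b = true → W.Satisfies .b)
    (hr : r = true → W.Satisfies .r) {used : List (Fin n → ℤ)} {I : Fin W.length}
    (hused : ∀ u ∈ used, ∃ j : Fin W.length, W.dir j = u ∧ j < I) {p q : Fin n → ℚ}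
    (hp : W.pt I.castSucc = castPt p) (hq : W.pt I.succ = castPt q) :
    isExcluded B d e b r used p (W.dir I) = false := by
  rw [← Bool.not_eq_true, isExcluded]
  simp only [Bool.or_eq_true, Bool.and_eq_true, decide_eq_true_eq, List.any_eq_true, not_or]
  refine ⟨⟨?_, ?_⟩, ?_⟩
  · rintro ⟨he', hcount⟩
    have hN := he he' I
    rw [hp, hq] at hN
    have hstep := W.pt_succ I
    rw [hp, hq] at hstep
    exact absurd (le_tightCount hN hstep) (by omega)
  · rintro ⟨hb', u, hu, hgu⟩
    obtain ⟨j, rfl, -⟩ := hused u hu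
    exact hb hb' I j hgu
  · rintro ⟨hr', u, hu, hgu⟩
    obtain ⟨j, rfl, hji⟩ := hused u hu
    exact hr hr' I j hji.ne' hgu

/-- Soundness of the search: if it finds no walk with at most `k` steps, there is none. -/
theorem lt_length_of_noWalk {L : List (Fin n → ℤ)} {e b r : Bool} {v w : Fin n → ℚ} {k : ℕ}
    (hL : ∀ g, (ofIneq B d).IsCircuit g → g ∈ L)
    (W : (ofIneq B d).CircuitWalk (castPt v) (castPt w)) (hf : W.Satisfies .f)
    (hm : W.Satisfies .m) (he : e = true → W.Satisfies .e) (hb : b = true → W.Satisfies .b)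
    (hr : r = true → W.Satisfies .r) (h : noWalk B d L e b r w k [] v = true) : k < W.length := by
  by_contra! hlen
  have key : ∀ (k i : ℕ) (hi : i ≤ W.length) (used : List (Fin n → ℤ)) (p : Fin n → ℚ),
      W.length ≤ i + k → W.pt ⟨i, Nat.lt_succ_of_le hi⟩ = castPt p →
      (∀ u ∈ used, ∃ j : Fin W.length, W.dir j = u ∧ j.1 < i) →
      noWalk B d L e b r w k used p = false := by
    intro k
    induction k with
    | zero =>
      intro i hi used p hik hp _
      obtain rfl : i = W.length := by omega
      have : castPt p = castPt w := hp ▸ W.pt_last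
      simp [noWalk, castPt_injective this]
    | succ k ih =>
      intro i hi used p hik hp hused
      rcases hi.eq_or_lt with rfl | hlt
      · have : castPt p = castPt w := hp ▸ W.pt_last
        rcases k with - | k <;> simp [noWalk, castPt_injective this]
      · set I : Fin W.length := ⟨i, hlt⟩ with hI
        have hpc : W.pt I.castSucc = castPt p := hp
        have hsucc : W.pt I.succ = castPt p + W.step I • toReal (W.dir I) := by
          rw [← hpc]
          exact eq_add_of_sub_eq' (W.pt_succ I)
        rcases k with - | k
        · have hlast : I.succ = Fin.last W.length := Fin.ext (by simp [hI]; omega)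
          have hw : castPt w = castPt p + W.step I • toReal (W.dir I) := by
            rw [← hsucc, hlast, W.pt_last]
          have hwj : ∀ j, (w j : ℝ) - p j = W.step I * W.dir I j := fun j => by
            have := congrFun hw j
            simp only [castPt, toReal, Pi.add_apply, Pi.smul_apply, smul_eq_mul] at this
            linarith
          rw [noWalk, Bool.and_eq_false_iff]
          right
          rw [List.all_eq_false]
          refine ⟨W.dir I, hL _ (W.isCircuit_dir I), ?_⟩
          rw [isExcluded_eq_false (q := w) W he hb hr hused hpc (by rw [hsucc, ← hw])]
          simp only [Bool.or_false, Bool.not_eq_true', Bool.not_eq_false, Bool.and_eq_true,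
            decide_eq_true_eq]
          constructor
          · have hpos : (0 : ℝ) < ∑ j, ((w j : ℝ) - p j) * W.dir I j := by
              obtain ⟨l, hl⟩ := Function.ne_iff.1 (W.isCircuit_dir I).2.1
              have hl' : (W.dir I l : ℝ) ≠ 0 := by exact_mod_cast hl
              simp only [hwj, mul_assoc]
              have hs := W.step_pos I
              exact Finset.sum_pos' (fun j _ => mul_nonneg hs.le (mul_self_nonneg _))
                ⟨l, Finset.mem_univ _, mul_pos hs (mul_self_pos.2 hl')⟩
            exact_mod_cast hpos
          · intro a b _
            have : ((w a : ℝ) - p a) * W.dir I b = (w b - p b) * W.dir I a := by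
              rw [hwj, hwj]
              ring
            exact_mod_cast this
        have hmem := hf I.succ
        rw [hsucc] at hmem
        obtain ⟨l, hl, hlt'⟩ := exists_blocking_row hmem (by
          have := hm I
          rwa [hpc] at this)
        rw [ineqMap_toReal] at hl
        have hl' : 0 < rowDir B l (W.dir I) := by exact_mod_cast hl
        rw [ineqMap_add, ineqMap_smul, Pi.add_apply, Pi.smul_apply, smul_eq_mul, ineqMap_toReal,
          ineqMap_castPt] at hlt'
        set t : ℚ := ((d l : ℚ) - rowVal B l p) / rowDir B l (W.dir I) with ht
        have htr : W.step I = (t : ℝ) := by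
          rw [ht]
          push_cast
          rw [eq_div_iff hl.ne']
          linarith
        set q : Fin n → ℚ := fun j => p j + t * W.dir I j with hq
        have hqr : W.pt I.succ = castPt q := by
          rw [hsucc, htr]
          funext j
          simp [castPt, hq, toReal]
        have ht0 : 0 < t := by
          have := W.step_pos I
          rw [htr] at this
          exact_mod_cast this
        have hrec := ih (i + 1) hlt (W.dir I :: used) q (by omega) hqr (by
          intro u hu
          rcases List.mem_cons.1 hu with rfl | hu
          · exact ⟨I, rfl, Nat.lt_succ_self i⟩
          · obtain ⟨j, hj, hji⟩ := hused u hu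
            exact ⟨j, hj, by omega⟩)
        have hfeas : ∀ l, rowVal B l q ≤ d l := castPt_mem_carrier.1 (hqr ▸ hf I.succ)
        rw [noWalk, Bool.and_eq_false_iff]
        right
        rw [List.all_eq_false]
        refine ⟨W.dir I, hL _ (W.isCircuit_dir I), ?_⟩
        rw [isExcluded_eq_false W he hb hr hused hpc hqr]
        simp only [Bool.or_eq_true, decide_eq_true_eq, not_or, Bool.false_eq_true,
          not_false_eq_true, true_and, List.all_eq_true, List.mem_finRange, forall_const,
          not_forall]
        refine ⟨l, ⟨?_, ?_, ?_, ?_⟩⟩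
        · omega
        · exact not_le.2 ht0
        · exact fun ⟨x, hx⟩ => hx (hfeas x)
        · rw [hrec]
          decide
  have := key k 0 (Nat.zero_le _) [] v (by omega) W.pt_zero (by simp)
  rw [this] at h
  exact absurd h (by decide)

end Rational

end Polyhedron

/-! ### Circuits and vertices in dimensions two and three -/

namespace Polyhedron

section LowDimension

variable {n m : ℕ}

lemma exists_eq_smul_of_parallel {z g : Fin n → ℝ} (hg : g ≠ 0)
    (h : ∀ i j, z i * g j = z j * g i) : ∃ c : ℝ, z = c • g := by
  obtain ⟨k, hk⟩ := Function.ne_iff.1 hg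
  refine ⟨z k / g k, funext fun i => ?_⟩
  have hk' : g k ≠ 0 := hk
  rw [Pi.smul_apply, smul_eq_mul, div_mul_eq_mul_div, eq_div_iff hk']
  exact h i k

lemma determinesLine_two {B : Matrix (Fin m) (Fin 2) ℤ} {S : Fin m → Prop} {g : Fin 2 → ℤ}
    (hg : g ≠ 0) (h : ∃ i, S i ∧ (B i 0 ≠ 0 ∨ B i 1 ≠ 0) ∧ rowDir B i g = 0) :
    DeterminesLine B S g := by
  obtain ⟨i, hi, hB, hgi⟩ := h
  intro z hz
  have h1 := hz i hi
  have h2 : (B i 0 : ℝ) * g 0 + B i 1 * g 1 = 0 := by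
    simp only [rowDir, Fin.sum_univ_two] at hgi
    exact_mod_cast hgi
  rw [Fin.sum_univ_two] at h1
  have h3 : z 0 * (g 1 : ℝ) = z 1 * g 0 := by
    rcases hB with hB | hB
    · have : (B i 0 : ℝ) ≠ 0 := by exact_mod_cast hB
      apply mul_left_cancel₀ this
      linear_combination (g 1 : ℝ) * h1 - z 1 * h2
    · have : (B i 1 : ℝ) ≠ 0 := by exact_mod_cast hB
      apply mul_left_cancel₀ this
      linear_combination z 0 * h2 - (g 0 : ℝ) * h1
  refine exists_eq_smul_of_parallel (toReal_ne_zero hg) fun i j => ?_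
  fin_cases i <;> fin_cases j <;> simp [toReal, h3]

/-- The vanishing of the cross product of two vectors. -/
abbrev CrossEqZero {R : Type*} [CommRing R] (r s : Fin 3 → R) : Prop :=
  r 1 * s 2 = r 2 * s 1 ∧ r 2 * s 0 = r 0 * s 2 ∧ r 0 * s 1 = r 1 * s 0

/-- Two vectors orthogonal to the same two independent vectors of `ℝ³` are parallel. -/
lemma parallel_of_orthogonal {r s z g : Fin 3 → ℝ} (h : ¬ CrossEqZero r s)
    (hrz : ∑ j, r j * z j = 0) (hsz : ∑ j, s j * z j = 0) (hrg : ∑ j, r j * g j = 0)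
    (hsg : ∑ j, s j * g j = 0) (i j : Fin 3) : z i * g j = z j * g i := by
  set c : Fin 3 → ℝ := ![r 1 * s 2 - r 2 * s 1, r 2 * s 0 - r 0 * s 2, r 0 * s 1 - r 1 * s 0]
    with hc
  have hc0 : c ≠ 0 := by
    intro h0
    have h1 := congrFun h0 0
    have h2 := congrFun h0 1
    have h3 := congrFun h0 2
    simp only [hc, Pi.zero_apply, Matrix.cons_val, sub_eq_zero] at h1 h2 h3
    exact h ⟨h1, h2, h3⟩
  -- `x × (r × s) = r (x · s) - s (x · r)`
  have key : ∀ x : Fin 3 → ℝ, ∑ j, r j * x j = 0 → ∑ j, s j * x j = 0 →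
      ∃ a : ℝ, x = a • c := by
    intro x hr hs
    rw [Fin.sum_univ_three] at hr hs
    have h1 : x 0 * c 1 = x 1 * c 0 := by
      simp only [hc, Matrix.cons_val]
      linear_combination r 2 * hs - s 2 * hr
    have h2 : x 1 * c 2 = x 2 * c 1 := by
      simp only [hc, Matrix.cons_val]
      linear_combination r 0 * hs - s 0 * hr
    have h3 : x 2 * c 0 = x 0 * c 2 := by
      simp only [hc, Matrix.cons_val]
      linear_combination r 1 * hs - s 1 * hr
    refine exists_eq_smul_of_parallel hc0 fun i j => ?_
    fin_cases i <;> fin_cases j <;> first | rfl | assumption | exact Eq.symm ‹_›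
  obtain ⟨a, rfl⟩ := key z hrz hsz
  obtain ⟨b, rfl⟩ := key g hrg hsg
  simp only [Pi.smul_apply, smul_eq_mul]
  ring

lemma CrossEqZero.cast {r s : Fin 3 → ℤ} :
    CrossEqZero (fun j => (r j : ℝ)) (fun j => (s j : ℝ)) ↔ CrossEqZero r s := by
  simp only [CrossEqZero]
  norm_cast

lemma rowDir_eq_zero_iff {B : Matrix (Fin m) (Fin n) ℤ} {i : Fin m} {g : Fin n → ℤ} :
    rowDir B i g = 0 ↔ ∑ j, (B i j : ℝ) * toReal g j = 0 := by
  simp only [rowDir, toReal]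
  norm_cast

lemma determinesLine_three {B : Matrix (Fin m) (Fin 3) ℤ} {S : Fin m → Prop} {g : Fin 3 → ℤ}
    (hg : g ≠ 0) (h : ∃ i j, S i ∧ S j ∧ ¬ CrossEqZero (B i) (B j) ∧ rowDir B i g = 0 ∧
      rowDir B j g = 0) : DeterminesLine B S g := by
  obtain ⟨i, j, hi, hj, hc, hgi, hgj⟩ := h
  intro z hz
  exact exists_eq_smul_of_parallel (toReal_ne_zero hg) (parallel_of_orthogonal
    (fun h => hc (CrossEqZero.cast.1 h)) (hz i hi) (hz j hj) (rowDir_eq_zero_iff.1 hgi)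
    (rowDir_eq_zero_iff.1 hgj))

/-- In the plane, a circuit is orthogonal to a nonzero row, so a list that contains both primitive
vectors orthogonal to each row contains all circuits. -/
lemma IsCircuit.mem_of_two {B : Matrix (Fin m) (Fin 2) ℤ} {d : Fin m → ℤ} {v : Fin 2 → ℝ}
    (hv : v ∈ (ofIneq B d).vertices) {L : List (Fin 2 → ℤ)}
    (hL : ∀ i, (B i 0 = 0 ∧ B i 1 = 0) ∨
      ∃ h ∈ L, rowDir B i h = 0 ∧ Finset.univ.gcd h = 1 ∧ -h ∈ L)
    (g : Fin 2 → ℤ) (hg : (ofIneq B d).IsCircuit g) : g ∈ L := by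
  obtain ⟨i, hi, hi0⟩ : ∃ i, rowDir B i g = 0 ∧ ¬ (B i 0 = 0 ∧ B i 1 = 0) := by
    by_contra! hno
    have hall : ∀ z : Fin 2 → ℝ, ∃ c : ℝ, z = c • toReal g := fun z =>
      hg.exists_eq_smul hv (eqMap_ofIneq _ _) fun i hi => by
        rw [ineqMap_toReal] at hi
        have h0 := hno i (by exact_mod_cast hi)
        rw [ineqMap_apply, Fin.sum_univ_two]
        change (B i 0 : ℝ) * z 0 + (B i 1 : ℝ) * z 1 = 0
        rw [h0.1, h0.2]
        simp
    obtain ⟨a, ha⟩ := hall ![1, 0]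
    obtain ⟨b, hb⟩ := hall ![0, 1]
    have h1 := congrFun ha 0
    have h2 := congrFun ha 1
    have h3 := congrFun hb 0
    have h4 := congrFun hb 1
    simp only [Matrix.cons_val, Pi.smul_apply, smul_eq_mul] at h1 h2 h3 h4
    have : (1 : ℝ) = 0 := by
      calc (1 : ℝ) = a * toReal g 0 * (b * toReal g 1) := by rw [← h1, ← h4, one_mul]
        _ = a * toReal g 1 * (b * toReal g 0) := by ring
        _ = 0 := by rw [← h2, zero_mul]
    exact one_ne_zero this
  obtain ⟨h, hh, hih, hgcd, hneg⟩ := (hL i).resolve_left hi0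
  have hne := ne_zero_of_gcd_eq_one hgcd
  obtain ⟨c, hc⟩ := determinesLine_two (B := B) (S := fun k => k = i) hne
    ⟨i, rfl, not_and_or.1 hi0, hih⟩ (toReal g) (by
      rintro k rfl
      exact rowDir_eq_zero_iff.1 hi)
  rcases eq_or_eq_neg_of_parallel hg.2.2.1 hgcd hc with rfl | rfl
  · exact hh
  · exact hneg

/-- In space, a circuit is orthogonal to two independent rows, so a list that contains both
primitive vectors orthogonal to each pair of independent rows contains all circuits. -/
lemma IsCircuit.mem_of_three {B : Matrix (Fin m) (Fin 3) ℤ} {d : Fin m → ℤ} {v : Fin 3 → ℝ}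
    (hv : v ∈ (ofIneq B d).vertices) {L : List (Fin 3 → ℤ)}
    (hL : ∀ i j, j < i → CrossEqZero (B i) (B j) ∨
      ∃ h ∈ L, rowDir B i h = 0 ∧ rowDir B j h = 0 ∧ Finset.univ.gcd h = 1 ∧ -h ∈ L)
    (g : Fin 3 → ℤ) (hg : (ofIneq B d).IsCircuit g) : g ∈ L := by
  have hL' : ∀ i j, ¬ CrossEqZero (B i) (B j) →
      ∃ h ∈ L, rowDir B i h = 0 ∧ rowDir B j h = 0 ∧ Finset.univ.gcd h = 1 ∧ -h ∈ L := by
    intro i j hij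
    rcases lt_trichotomy i j with h | rfl | h
    · obtain ⟨g, h1, h2, h3, h4⟩ := (hL j i h).resolve_left fun hc => hij
        ⟨by linarith [hc.1], by linarith [hc.2.1], by linarith [hc.2.2]⟩
      exact ⟨g, h1, h3, h2, h4⟩
    · exact absurd ⟨mul_comm _ _, mul_comm _ _, mul_comm _ _⟩ hij
    · exact (hL i j h).resolve_left hij
  obtain ⟨i, j, hi, hj, hij⟩ : ∃ i j, rowDir B i g = 0 ∧ rowDir B j g = 0 ∧
      ¬ CrossEqZero (B i) (B j) := by
    by_contra! hno
    -- all rows orthogonal to `g` are multiples of one row `r`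
    obtain ⟨r, hr⟩ : ∃ r : Fin 3 → ℝ, r ≠ 0 ∧ ∑ j, r j * toReal g j = 0 ∧
        ∀ i, rowDir B i g = 0 → ∀ z : Fin 3 → ℝ, ∑ j, r j * z j = 0 →
          ∑ j, (B i j : ℝ) * z j = 0 := by
      by_cases hex : ∃ i, rowDir B i g = 0 ∧ B i ≠ 0
      · obtain ⟨i, hi, hi0⟩ := hex
        have hr0 : (fun j => (B i j : ℝ)) ≠ 0 := fun h => hi0 (funext fun j => by
          simpa using congrFun h j)
        refine ⟨fun j => B i j, hr0, rowDir_eq_zero_iff.1 hi, fun k hk z hz => ?_⟩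
        obtain ⟨h1, h2, h3⟩ := CrossEqZero.cast.2 (hno k i hk hi)
        obtain ⟨c, hc⟩ := exists_eq_smul_of_parallel (z := fun j => (B k j : ℝ)) hr0
          (fun a b => by
            fin_cases a <;> fin_cases b <;> simp only [Fin.reduceFinMk, Fin.zero_eta, Fin.mk_one] <;>
              linarith)
        have hck : ∀ j, (B k j : ℝ) = c * B i j := fun j => congrFun hc j
        simp only [hck, mul_assoc]
        rw [← Finset.mul_sum, hz, mul_zero]
      · push Not at hex
        obtain ⟨k, hk⟩ := Function.ne_iff.1 (toReal_ne_zero hg.2.1)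
        have hk' : toReal g k ≠ 0 := hk
        have hsome : ∃ r : Fin 3 → ℝ, r ≠ 0 ∧ ∑ j, r j * toReal g j = 0 := by
          by_cases h0 : toReal g 0 = 0
          · exact ⟨![1, 0, 0], fun h => by simpa using congrFun h 0, by
              simp [Fin.sum_univ_three, h0]⟩
          · exact ⟨![-toReal g 1, toReal g 0, 0], fun h => h0 (by simpa using congrFun h 1), by
              simp [Fin.sum_univ_three]; ring⟩
        obtain ⟨r, h1, h2⟩ := hsome
        refine ⟨r, h1, h2, fun i hi z _ => ?_⟩
        simp [hex i hi]
    obtain ⟨hr0, hrg, hz⟩ := hr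
    have hall : ∀ z : Fin 3 → ℝ, ∑ j, r j * z j = 0 → ∃ c : ℝ, z = c • toReal g := fun z hrz =>
      hg.exists_eq_smul hv (eqMap_ofIneq _ _) fun i hi => by
        rw [ineqMap_toReal] at hi
        exact hz i (by exact_mod_cast hi) z hrz
    -- the cross product of `r` and `g` is orthogonal to both
    set x : Fin 3 → ℝ := toReal g with hx
    obtain ⟨c, hc⟩ := hall ![r 1 * x 2 - r 2 * x 1, r 2 * x 0 - r 0 * x 2, r 0 * x 1 - r 1 * x 0]
      (by simp [Fin.sum_univ_three]; ring)
    have h0 := congrFun hc 0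
    have h1 := congrFun hc 1
    have h2 := congrFun hc 2
    simp only [Matrix.cons_val, Pi.smul_apply, smul_eq_mul] at h0 h1 h2
    simp only [Fin.sum_univ_three] at hrg
    have hx0 : x ≠ 0 := toReal_ne_zero hg.2.1
    have hxx : 0 < x 0 * x 0 + x 1 * x 1 + x 2 * x 2 := by
      obtain ⟨k, hk⟩ := Function.ne_iff.1 hx0
      have : 0 < x k * x k := mul_self_pos.2 hk
      have := mul_self_nonneg (x 0)
      have := mul_self_nonneg (x 1)
      have := mul_self_nonneg (x 2)
      fin_cases k <;> simp only [Fin.reduceFinMk, Fin.zero_eta, Fin.mk_one] at * <;> linarith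
    have hc0 : c = 0 := by
      have : c * (x 0 * x 0 + x 1 * x 1 + x 2 * x 2) = 0 := by
        linear_combination (-x 0) * h0 - x 1 * h1 - x 2 * h2
      exact (mul_eq_zero.1 this).resolve_right hxx.ne'
    rw [hc0] at h0 h1 h2
    have hrr : 0 < r 0 * r 0 + r 1 * r 1 + r 2 * r 2 := by
      obtain ⟨k, hk⟩ := Function.ne_iff.1 hr0
      have : 0 < r k * r k := mul_self_pos.2 hk
      have := mul_self_nonneg (r 0)
      have := mul_self_nonneg (r 1)
      have := mul_self_nonneg (r 2)
      fin_cases k <;> simp only [Fin.reduceFinMk, Fin.zero_eta, Fin.mk_one] at * <;> linarith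
    have : (r 0 * r 0 + r 1 * r 1 + r 2 * r 2) * (x 0 * x 0 + x 1 * x 1 + x 2 * x 2) = 0 := by
      linear_combination (r 0 * x 0 + r 1 * x 1 + r 2 * x 2) * hrg +
        (r 1 * x 2 - r 2 * x 1) * h0 + (r 2 * x 0 - r 0 * x 2) * h1 + (r 0 * x 1 - r 1 * x 0) * h2
    exact (mul_pos hrr hxx).ne' this
  obtain ⟨h, hh, hih, hjh, hgcd, hneg⟩ := hL' i j hij
  have hne := ne_zero_of_gcd_eq_one hgcd
  obtain ⟨c, hc⟩ := determinesLine_three (B := B) (S := fun k => k = i ∨ k = j) hne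
    ⟨i, j, Or.inl rfl, Or.inr rfl, hij, hih, hjh⟩ (toReal g) (by
      rintro k (rfl | rfl)
      · exact rowDir_eq_zero_iff.1 hi
      · exact rowDir_eq_zero_iff.1 hj)
  rcases eq_or_eq_neg_of_parallel hg.2.2.1 hgcd hc with rfl | rfl
  · exact hh
  · exact hneg

lemma mem_vertices_two {B : Matrix (Fin m) (Fin 2) ℤ} {d : Fin m → ℤ} {p : Fin 2 → ℚ}
    (hp : ∀ i, rowVal B i p ≤ d i)
    (h : ∃ i j, rowVal B i p = d i ∧ rowVal B j p = d j ∧ B i 0 * B j 1 ≠ B i 1 * B j 0) :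
    castPt p ∈ (ofIneq B d).vertices := by
  refine mem_vertices_of_tight (castPt_mem_carrier.2 hp) fun z _ hz => ?_
  obtain ⟨i, j, hi, hj, hdet⟩ := h
  have h1 := hz i (ineqMap_castPt_eq_iff.2 hi)
  have h2 := hz j (ineqMap_castPt_eq_iff.2 hj)
  rw [ineqMap_apply, Fin.sum_univ_two] at h1 h2
  change (B i 0 : ℝ) * z 0 + (B i 1 : ℝ) * z 1 = 0 at h1
  change (B j 0 : ℝ) * z 0 + (B j 1 : ℝ) * z 1 = 0 at h2
  have hdet' : (B i 0 : ℝ) * B j 1 - B i 1 * B j 0 ≠ 0 := sub_ne_zero.2 (by exact_mod_cast hdet)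
  funext k
  fin_cases k
  · exact mul_left_cancel₀ hdet' (by
      simp only [Fin.zero_eta, Pi.zero_apply]
      linear_combination (B j 1 : ℝ) * h1 - (B i 1 : ℝ) * h2)
  · exact mul_left_cancel₀ hdet' (by
      simp only [Fin.mk_one, Pi.zero_apply]
      linear_combination (B i 0 : ℝ) * h2 - (B j 0 : ℝ) * h1)

lemma mem_vertices_three {B : Matrix (Fin m) (Fin 3) ℤ} {d : Fin m → ℤ} {p : Fin 3 → ℚ}
    (hp : ∀ i, rowVal B i p ≤ d i)
    (h : ∃ i j k, rowVal B i p = d i ∧ rowVal B j p = d j ∧ rowVal B k p = d k ∧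
      (Matrix.of ![B i, B j, B k]).det ≠ 0) :
    castPt p ∈ (ofIneq B d).vertices := by
  refine mem_vertices_of_tight (castPt_mem_carrier.2 hp) fun z _ hz => ?_
  obtain ⟨i, j, k, hi, hj, hk, hdet⟩ := h
  have h1 := hz i (ineqMap_castPt_eq_iff.2 hi)
  have h2 := hz j (ineqMap_castPt_eq_iff.2 hj)
  have h3 := hz k (ineqMap_castPt_eq_iff.2 hk)
  refine Matrix.eq_zero_of_mulVec_eq_zero (M := (Matrix.of ![B i, B j, B k]).map (Int.cast : ℤ → ℝ))
    ?_ ?_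
  · have h4 := (Int.castRingHom ℝ).map_det (Matrix.of ![B i, B j, B k])
    rw [RingHom.mapMatrix_apply] at h4
    change ((Matrix.of ![B i, B j, B k]).map (Int.castRingHom ℝ)).det ≠ 0
    rw [← h4]
    simpa using hdet
  · funext l
    fin_cases l
    · exact h1
    · exact h2
    · exact h3

lemma interior_nonempty_of_lt {B : Matrix (Fin m) (Fin n) ℤ} {d : Fin m → ℤ} (p : Fin n → ℚ)
    (hp : ∀ i, rowVal B i p < d i) : (interior (ofIneq B d).carrier).Nonempty := by
  refine ⟨castPt p, mem_interior.2 ⟨{z | ∀ i, (ofIneq B d).ineqMap z i < d i},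
    fun z hz => ⟨eqMap_ofIneq _ _, fun i => (hz i).le⟩, ?_, fun i => ?_⟩⟩
  · rw [Set.ofPred_forall]
    exact isOpen_iInter_of_finite fun i =>
      isOpen_lt ((continuous_apply i).comp continuous_ineqMap) continuous_const
  · rw [ineqMap_castPt]
    exact_mod_cast hp i

lemma isBounded_of_abs_le {s : Set (Fin n → ℝ)} (M : ℝ) (h : ∀ z ∈ s, ∀ j, |z j| ≤ M) :
    Bornology.IsBounded s := by
  refine (Metric.isBounded_closedBall (x := (0 : Fin n → ℝ)) (r := max M 0)).subset fun z hz => ?_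
  rw [mem_closedBall_zero_iff, pi_norm_le_iff_of_nonneg (le_max_right _ _)]
  exact fun j => (h z hz j).trans (le_max_left _ _)

lemma row_le_of_mem_carrier {B : Matrix (Fin m) (Fin n) ℤ} {d : Fin m → ℤ} {z : Fin n → ℝ}
    (hz : z ∈ (ofIneq B d).carrier) (i : Fin m) : ∑ j, (B i j : ℝ) * z j ≤ d i := hz.2 i

end LowDimension

end Polyhedron

/-! ### Criteria for upper and lower bounds -/

namespace Polyhedron

section Criteria

variable {n m k : ℕ}

/-- A Boolean test that certifies that the rows of `S` orthogonal to `g` determine the line `ℝ g`.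
-/
def IsLineTest (B : Matrix (Fin m) (Fin n) ℤ) (T : (Fin m → Bool) → (Fin n → ℤ) → Bool) : Prop :=
  ∀ S g, g ≠ 0 → T S g = true → DeterminesLine B (fun i => S i = true ∧ rowDir B i g = 0) g

/-- In the plane, one nonzero row orthogonal to `g` suffices. -/
def lineTestTwo (B : Matrix (Fin m) (Fin 2) ℤ) (S : Fin m → Bool) (g : Fin 2 → ℤ) : Bool :=
  decide (∃ i, S i = true ∧ (B i 0 ≠ 0 ∨ B i 1 ≠ 0) ∧ rowDir B i g = 0)

/-- In space, two independent rows orthogonal to `g` suffice. -/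
def lineTestThree (B : Matrix (Fin m) (Fin 3) ℤ) (S : Fin m → Bool) (g : Fin 3 → ℤ) : Bool :=
  decide (∃ i j, S i = true ∧ S j = true ∧ ¬ CrossEqZero (B i) (B j) ∧ rowDir B i g = 0 ∧
    rowDir B j g = 0)

lemma isLineTest_two (B : Matrix (Fin m) (Fin 2) ℤ) : IsLineTest B (lineTestTwo B) := by
  intro S g hg h
  obtain ⟨i, h1, h2, h3⟩ := of_decide_eq_true h
  exact determinesLine_two hg ⟨i, ⟨h1, h3⟩, h2, h3⟩

lemma isLineTest_three (B : Matrix (Fin m) (Fin 3) ℤ) : IsLineTest B (lineTestThree B) := by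
  intro S g hg h
  obtain ⟨i, j, h1, h2, h3, h4, h5⟩ := of_decide_eq_true h
  exact determinesLine_three hg ⟨i, j, ⟨h1, h4⟩, ⟨h2, h5⟩, h3, h4, h5⟩

lemma IsLineTest.isCircuit {B : Matrix (Fin m) (Fin n) ℤ} {d : Fin m → ℤ}
    {T : (Fin m → Bool) → (Fin n → ℤ) → Bool} (hT : IsLineTest B T) {g : Fin n → ℤ}
    (hg : Finset.univ.gcd g = 1) (h : T (fun _ => true) g = true) : (ofIneq B d).IsCircuit g :=
  isCircuit_of_determinesLine hg ((hT _ g (ne_zero_of_gcd_eq_one hg) h).mono fun _ hi => hi.2)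

/-- Decidable criteria on the rational data of a walk that imply the restrictions. -/
def WalkCriterion (B : Matrix (Fin m) (Fin n) ℤ) (d : Fin m → ℤ)
    (T : (Fin m → Bool) → (Fin n → ℤ) → Bool) (pt : Fin (k + 1) → Fin n → ℚ)
    (dir : Fin k → Fin n → ℤ) : Restriction → Prop
  | .e => (∀ i r, rowVal B r (pt i) ≤ d r) ∧ ∀ i : Fin k,
      T (fun r => decide (rowVal B r (pt i.castSucc) = d r)) (dir i) = true ∧
      (∃ r, rowDir B r (dir i) < 0 ∧ rowVal B r (pt i.castSucc) = d r) ∧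
      ∃ r, 0 < rowDir B r (dir i) ∧ rowVal B r (pt i.succ) = d r
  | .f => ∀ i r, rowVal B r (pt i) ≤ d r
  | .m => ∀ i : Fin k, ∃ r, 0 < rowDir B r (dir i) ∧ rowVal B r (pt i.succ) = d r
  | .r => ∀ i j, i ≠ j → dir i ≠ dir j
  | .b => ∀ i j, dir i ≠ -dir j
  | .s => (∀ i j r, 0 ≤ rowDir B r (dir i) * rowDir B r (dir j)) ∧
      ∀ i r, 0 ≤ (rowDir B r (dir i) : ℚ) * (rowVal B r (pt (Fin.last k)) - rowVal B r (pt 0))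

instance (B : Matrix (Fin m) (Fin n) ℤ) (d : Fin m → ℤ)
    (T : (Fin m → Bool) → (Fin n → ℤ) → Bool) (pt : Fin (k + 1) → Fin n → ℚ)
    (dir : Fin k → Fin n → ℤ) : DecidablePred (WalkCriterion B d T pt dir) := fun c => by
  cases c <;> unfold WalkCriterion <;> infer_instance

lemma CD_le_of_walkCriterion {B : Matrix (Fin m) (Fin n) ℤ} {d : Fin m → ℤ}
    {T : (Fin m → Bool) → (Fin n → ℤ) → Bool} (hT : IsLineTest B T)
    (pt : Fin (k + 1) → Fin n → ℚ) (dir : Fin k → Fin n → ℤ) (step : Fin k → ℚ)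
    (hc : ∀ i, (ofIneq B d).IsCircuit (dir i))
    (h : (∀ i, 0 < step i) ∧ ∀ i j, pt i.succ j = pt i.castSucc j + step i * dir i j)
    {R : Set Restriction} (hR : ∀ c ∈ R, WalkCriterion B d T pt dir c) :
    (ofIneq B d).CD R (castPt (pt 0)) (castPt (pt (Fin.last k))) ≤ k := by
  obtain ⟨hs, hp⟩ := h
  refine CD_le (walkOfData pt dir step hc hs hp) fun c hcR => ?_
  have hcrit := hR c hcR
  cases c with
  | e =>
    exact walkOfData_edge hc hs hp hcrit.1
      (fun i => (hT _ _ (hc i).2.1 (hcrit.2 i).1).mono fun _ hr => ⟨of_decide_eq_true hr.1, hr.2⟩)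
      (fun i => (hcrit.2 i).2.1) fun i => (hcrit.2 i).2.2
  | f => exact walkOfData_feasible hc hs hp hcrit
  | m => exact walkOfData_maximal hc hs hp hcrit
  | r => exact hcrit
  | b => exact hcrit
  | s =>
    refine ⟨fun i j r => ?_, fun i r => ?_⟩
    · change 0 ≤ (ofIneq B d).ineqMap (toReal (dir i)) r * (ofIneq B d).ineqMap (toReal (dir j)) r
      rw [ineqMap_toReal, ineqMap_toReal]
      exact_mod_cast hcrit.1 i j r
    · change 0 ≤ (ofIneq B d).ineqMap (toReal (dir i)) r * _
      rw [ineqMap_toReal, ineqMap_sub, Pi.sub_apply, ineqMap_castPt, ineqMap_castPt]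
      exact_mod_cast hcrit.2 i r

lemma CD_le_two {B : Matrix (Fin m) (Fin 2) ℤ} {d : Fin m → ℤ}
    (pt : Fin (k + 1) → Fin 2 → ℚ) (dir : Fin k → Fin 2 → ℤ) (step : Fin k → ℚ)
    (hc : ∀ i, Finset.univ.gcd (dir i) = 1 ∧ lineTestTwo B (fun _ => true) (dir i) = true)
    (h : (∀ i, 0 < step i) ∧ ∀ i j, pt i.succ j = pt i.castSucc j + step i * dir i j)
    {R : Set Restriction} (hR : ∀ c ∈ R, WalkCriterion B d (lineTestTwo B) pt dir c) :
    (ofIneq B d).CD R (castPt (pt 0)) (castPt (pt (Fin.last k))) ≤ k :=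
  CD_le_of_walkCriterion (isLineTest_two B) pt dir step
    (fun i => (isLineTest_two B).isCircuit (hc i).1 (hc i).2) h hR

lemma CD_le_three {B : Matrix (Fin m) (Fin 3) ℤ} {d : Fin m → ℤ}
    (pt : Fin (k + 1) → Fin 3 → ℚ) (dir : Fin k → Fin 3 → ℤ) (step : Fin k → ℚ)
    (hc : ∀ i, Finset.univ.gcd (dir i) = 1 ∧ lineTestThree B (fun _ => true) (dir i) = true)
    (h : (∀ i, 0 < step i) ∧ ∀ i j, pt i.succ j = pt i.castSucc j + step i * dir i j)
    {R : Set Restriction} (hR : ∀ c ∈ R, WalkCriterion B d (lineTestThree B) pt dir c) :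
    (ofIneq B d).CD R (castPt (pt 0)) (castPt (pt (Fin.last k))) ≤ k :=
  CD_le_of_walkCriterion (isLineTest_three B) pt dir step
    (fun i => (isLineTest_three B).isCircuit (hc i).1 (hc i).2) h hR

/-- Lower bounds for restricted maximal walks from a search that finds no shorter walk. -/
lemma le_CD_of_noWalk {B : Matrix (Fin m) (Fin n) ℤ} {d : Fin m → ℤ}
    {L : List (Fin n → ℤ)} (hL : ∀ g, (ofIneq B d).IsCircuit g → g ∈ L) {v w : Fin n → ℚ}
    {R : Set Restriction} (hf : .f ∈ R) (hm : .m ∈ R) (e b r : Bool) (he : e = true → .e ∈ R)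
    (hb : b = true → .b ∈ R) (hr : r = true → .r ∈ R)
    (h : noWalk B d L e b r w k [] v = true) :
    ((k + 1 : ℕ) : ℕ∞) ≤ (ofIneq B d).CD R (castPt v) (castPt w) :=
  le_CD fun W hW => lt_length_of_noWalk hL W (hW _ hf) (hW _ hm) (fun h => hW _ (he h))
    (fun h => hW _ (hb h)) (fun h => hW _ (hr h)) h

end Criteria

end Polyhedron

lemma strictlyBounds_of_polyhedron {n mA mB : ℕ} {R S : Set Restriction} (hRS : WeaklyBounds R S)
    (P : Polyhedron n mA mB) (hbdd : Bornology.IsBounded P.carrier)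
    (hint : (interior P.carrier).Nonempty) {v w : Fin n → ℝ} (hv : v ∈ P.vertices)
    (hw : w ∈ P.vertices) {a b : ℕ} (hS : P.CD S v w ≤ a) (hR : ((a + 1 : ℕ) : ℕ∞) ≤ P.CD R v w)
    (hfin : P.CD R v w ≤ b) : StrictlyBounds n R S := by
  refine ⟨hRS, mA, mB, P, hbdd, hint, v, hv, w, hw, ?_, hfin.trans_lt (ENat.natCast_lt_top b)⟩
  refine hS.trans_lt (lt_of_lt_of_le ?_ hR)
  exact_mod_cast Nat.lt_succ_self a

namespace Polyhedron

/-! ### A heptagon -/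

/-- The rows of the heptagon with vertices `(0,0), (1,-2), (3,-3), (5,-2), (6,0), (6,1), (0,1)`. -/
def heptB : Matrix (Fin 7) (Fin 2) ℤ := !![-1, 0; -2, -1; -1, -2; 1, -2; 2, -1; 1, 0; 0, 1]

/-- The right-hand side of the heptagon. -/
def heptD : Fin 7 → ℤ := ![0, 0, 3, 9, 12, 6, 1]

/-- The circuits of the heptagon. -/
def heptL : List (Fin 2 → ℤ) :=
  [![0, 1], ![0, -1], ![1, 0], ![-1, 0], ![1, -2], ![-1, 2], ![2, -1], ![-2, 1], ![2, 1],
    ![-2, -1], ![1, 2], ![-1, -2]]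

lemma hept_start : castPt ![0, 0] ∈ (ofIneq heptB heptD).vertices :=
  mem_vertices_two (by decide +kernel) (by decide +kernel)

lemma hept_end : castPt ![6, 0] ∈ (ofIneq heptB heptD).vertices :=
  mem_vertices_two (by decide +kernel) (by decide +kernel)

lemma hept_isCircuit : ∀ g, (ofIneq heptB heptD).IsCircuit g → g ∈ heptL :=
  IsCircuit.mem_of_two hept_start (by decide +kernel)

lemma hept_isBounded : Bornology.IsBounded (ofIneq heptB heptD).carrier := by
  refine isBounded_of_abs_le 6 fun z hz => ?_
  have h := row_le_of_mem_carrier hz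
  simp [Fin.forall_fin_succ, heptB, heptD] at h ⊢
  constructor <;> rw [abs_le] <;> constructor <;> linarith

lemma hept_interior : (interior (ofIneq heptB heptD).carrier).Nonempty :=
  interior_nonempty_of_lt ![1, 0] (by decide +kernel)

/-- From `(0,0)` to `(6,0)` the three upper edges form the shortest edge walk, but they contain a
pair of opposite directions; the four lower edges do not. -/
theorem strictlyBounds_efmb_efm : StrictlyBounds 2 {.e, .f, .m, .b} {.e, .f, .m} := by
  refine strictlyBounds_of_polyhedron (weaklyBounds_of_subset (by simp [Set.insert_subset_iff])) _
    hept_isBounded hept_interior hept_start hept_end (a := 3) (b := 4) ?_ ?_ ?_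
  · exact CD_le_two ![![0, 0], ![0, 1], ![6, 1], ![6, 0]]
      ![![0, 1], ![1, 0], ![0, -1]] ![1, 6, 1] (by decide +kernel) (by decide +kernel)
      (by rintro c (rfl | rfl | rfl) <;> decide +kernel)
  · exact le_CD_of_noWalk hept_isCircuit (by simp) (by simp) true true false (by simp) (by simp)
      (by simp) (by decide +kernel)
  · exact CD_le_two ![![0, 0], ![1, -2], ![3, -3], ![5, -2], ![6, 0]]
      ![![1, -2], ![2, -1], ![2, 1], ![1, 2]] ![1, 1, 1, 1] (by decide +kernel) (by decide +kernel)
      (by rintro c (rfl | rfl | rfl | rfl) <;> decide +kernel)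

/-! ### A pentagon -/

/-- The rows of the pentagon with vertices `(0,0), (2,0), (2,1), (1,2), (0,2)`. -/
def pentB : Matrix (Fin 5) (Fin 2) ℤ := !![-1, 0; 0, -1; 1, 0; 0, 1; 1, 1]

/-- The right-hand side of the pentagon. -/
def pentD : Fin 5 → ℤ := ![0, 0, 2, 2, 3]

/-- The circuits of the pentagon. -/
def pentL : List (Fin 2 → ℤ) := [![0, 1], ![0, -1], ![1, 0], ![-1, 0], ![1, -1], ![-1, 1]]

lemma pent_start : castPt ![2, 0] ∈ (ofIneq pentB pentD).vertices :=
  mem_vertices_two (by decide +kernel) (by decide +kernel)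

lemma pent_end : castPt ![0, 2] ∈ (ofIneq pentB pentD).vertices :=
  mem_vertices_two (by decide +kernel) (by decide +kernel)

lemma pent_isCircuit : ∀ g, (ofIneq pentB pentD).IsCircuit g → g ∈ pentL :=
  IsCircuit.mem_of_two pent_start (by decide +kernel)

lemma pent_isBounded : Bornology.IsBounded (ofIneq pentB pentD).carrier := by
  refine isBounded_of_abs_le 2 fun z hz => ?_
  have h := row_le_of_mem_carrier hz
  simp [Fin.forall_fin_succ, pentB, pentD] at h ⊢
  constructor <;> rw [abs_le] <;> constructor <;> linarith

lemma pent_interior : (interior (ofIneq pentB pentD).carrier).Nonempty :=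
  interior_nonempty_of_lt ![1, 1] (by decide +kernel)

/-- The diagonal from `(2,0)` to `(0,2)` is parallel to an edge, hence a maximal circuit step, but
edge walks need two steps. -/
theorem strictlyBounds_edge {R S : Set Restriction} (hSR : S ⊆ R) (he : .e ∈ R) (hf : .f ∈ R)
    (hm : .m ∈ R) (hs : .s ∉ R) (hS : .e ∉ S) : StrictlyBounds 2 R S := by
  refine strictlyBounds_of_polyhedron (weaklyBounds_of_subset hSR) _
    pent_isBounded pent_interior pent_start pent_end (a := 1) (b := 2) ?_ ?_ ?_
  · refine CD_le_two ![![2, 0], ![0, 2]] ![![-1, 1]] ![2] (by decide +kernel) (by decide +kernel)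
      fun c hc => ?_
    cases c
    case e => exact absurd hc hS
    all_goals decide +kernel
  · exact le_CD_of_noWalk pent_isCircuit hf hm true false false (fun _ => he) (by simp)
      (by simp) (by decide +kernel)
  · refine CD_le_two ![![2, 0], ![0, 0], ![0, 2]] ![![-1, 0], ![0, 1]] ![2, 2]
      (by decide +kernel) (by decide +kernel) fun c hc => ?_
    cases c
    case s => exact absurd hc hs
    all_goals decide +kernel

/-! ### A hexagon -/

/-- The rows of the hexagon with vertices `(0,0), (2,0), (3,2), (3,3), (2,3), (0,2)`. -/
def hexB : Matrix (Fin 6) (Fin 2) ℤ := !![0, -1; 2, -1; 1, 0; 0, 1; -1, 2; -1, 0]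

/-- The right-hand side of the hexagon. -/
def hexD : Fin 6 → ℤ := ![0, 4, 3, 3, 4, 0]

/-- The circuits of the hexagon. -/
def hexL : List (Fin 2 → ℤ) :=
  [![0, 1], ![0, -1], ![1, 0], ![-1, 0], ![1, 2], ![-1, -2], ![2, 1], ![-2, -1]]

lemma hex_start : castPt ![0, 0] ∈ (ofIneq hexB hexD).vertices :=
  mem_vertices_two (by decide +kernel) (by decide +kernel)

lemma hex_end : castPt ![3, 3] ∈ (ofIneq hexB hexD).vertices :=
  mem_vertices_two (by decide +kernel) (by decide +kernel)

lemma hex_isCircuit : ∀ g, (ofIneq hexB hexD).IsCircuit g → g ∈ hexL :=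
  IsCircuit.mem_of_two hex_start (by decide +kernel)

lemma hex_isBounded : Bornology.IsBounded (ofIneq hexB hexD).carrier := by
  refine isBounded_of_abs_le 3 fun z hz => ?_
  have h := row_le_of_mem_carrier hz
  simp [Fin.forall_fin_succ, hexB, hexD] at h ⊢
  constructor <;> rw [abs_le] <;> constructor <;> linarith

lemma hex_interior : (interior (ofIneq hexB hexD).carrier).Nonempty :=
  interior_nonempty_of_lt ![1, 1] (by decide +kernel)

/-- From `(0,0)` to `(3,3)` there are two feasible steps along `(1,2)` and `(2,1)`, but they are not
maximal, and maximal walks need three steps. -/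
theorem strictlyBounds_maximal {R S : Set Restriction} (hSR : S ⊆ R) (hf : .f ∈ R) (hm : .m ∈ R)
    (hRe : .e ∉ R) (hRs : .s ∉ R) (hS : .m ∉ S) : StrictlyBounds 2 R S := by
  refine strictlyBounds_of_polyhedron (weaklyBounds_of_subset hSR) _
    hex_isBounded hex_interior hex_start hex_end (a := 2) (b := 3) ?_ ?_ ?_
  · refine CD_le_two ![![0, 0], ![1, 2], ![3, 3]] ![![1, 2], ![2, 1]] ![1, 1]
      (by decide +kernel) (by decide +kernel) fun c hc => ?_
    cases c
    case m => exact absurd hc hS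
    case e => exact absurd (hSR hc) hRe
    case s => exact absurd (hSR hc) hRs
    all_goals decide +kernel
  · exact le_CD_of_noWalk hex_isCircuit hf hm false false false (by simp) (by simp)
      (by simp) (by decide +kernel)
  · refine CD_le_two ![![0, 0], ![0, 2], ![2, 3], ![3, 3]]
      ![![0, 1], ![2, 1], ![1, 0]] ![2, 1, 1] (by decide +kernel) (by decide +kernel) fun c hc => ?_
    cases c
    case e => exact absurd hc hRe
    case s => exact absurd hc hRs
    all_goals decide +kernel

/-! ### An octagon -/

/-- The rows of the octagon with vertices
`(-2,-17), (12,-17), (12,10), (-7,10), (-9,9), (-10,8), (-11,6), (-11,1)`. -/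
def octB : Matrix (Fin 8) (Fin 2) ℤ :=
  !![-2, -1; 0, -1; 1, 0; 0, 1; -1, 2; -1, 1; -2, 1; -1, 0]

/-- The right-hand side of the octagon. -/
def octD : Fin 8 → ℤ := ![21, 17, 12, 10, 27, 18, 28, 11]

/-- The circuits of the octagon. -/
def octL : List (Fin 2 → ℤ) :=
  [![1, -2], ![-1, 2], ![1, 0], ![-1, 0], ![0, 1], ![0, -1], ![2, 1], ![-2, -1], ![1, 1],
    ![-1, -1], ![1, 2], ![-1, -2]]

lemma oct_start : castPt ![12, -17] ∈ (ofIneq octB octD).vertices :=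
  mem_vertices_two (by decide +kernel) (by decide +kernel)

lemma oct_end : castPt ![-10, 8] ∈ (ofIneq octB octD).vertices :=
  mem_vertices_two (by decide +kernel) (by decide +kernel)

lemma oct_isCircuit : ∀ g, (ofIneq octB octD).IsCircuit g → g ∈ octL :=
  IsCircuit.mem_of_two oct_start (by decide +kernel)

lemma oct_isBounded : Bornology.IsBounded (ofIneq octB octD).carrier := by
  refine isBounded_of_abs_le 20 fun z hz => ?_
  have h := row_le_of_mem_carrier hz
  simp [Fin.forall_fin_succ, octB, octD] at h ⊢
  constructor <;> rw [abs_le] <;> constructor <;> linarith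

lemma oct_interior : (interior (ofIneq octB octD).carrier).Nonempty :=
  interior_nonempty_of_lt ![0, 0] (by decide +kernel)

/-- From `(12,-17)` to `(-10,8)` there is a maximal walk with the directions `(0,1)`, `(-2,-1)`,
`(0,1)`; every maximal walk that avoids repetitions has at least four steps. -/
theorem strictlyBounds_fmr_fm : StrictlyBounds 2 {.f, .m, .r} {.f, .m} := by
  refine strictlyBounds_of_polyhedron (weaklyBounds_of_subset (by simp [Set.insert_subset_iff])) _
    oct_isBounded oct_interior oct_start oct_end (a := 3) (b := 4) ?_ ?_ ?_
  · exact CD_le_two ![![12, -17], ![12, 10], ![-10, -1], ![-10, 8]]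
      ![![0, 1], ![-2, -1], ![0, 1]] ![27, 11, 9] (by decide +kernel) (by decide +kernel)
      (by rintro c (rfl | rfl) <;> decide +kernel)
  · exact le_CD_of_noWalk oct_isCircuit (by simp) (by simp) false false true (by simp) (by simp)
      (by simp) (by decide +kernel)
  · exact CD_le_two ![![12, -17], ![-2, -17], ![-11, 1], ![-11, 6], ![-10, 8]]
      ![![-1, 0], ![-1, 2], ![0, 1], ![1, 2]] ![14, 9, 5, 1] (by decide +kernel) (by decide +kernel)
      (by rintro c (rfl | rfl | rfl) <;> decide +kernel)

/-! ### A decagon -/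

/-- The rows of the decagon with vertices `(7,-67), (29,-56), (51,-12), (51,-3), (0,48), (-39,48),
(-51,42), (-54,39), (-58,31), (-58,-2)`. -/
def decB : Matrix (Fin 10) (Fin 2) ℤ :=
  !![-1, -1; 1, -2; 2, -1; 1, 0; 1, 1; 0, 1; -1, 2; -1, 1; -2, 1; -1, 0]

/-- The right-hand side of the decagon. -/
def decD : Fin 10 → ℤ := ![60, 141, 114, 51, 48, 48, 135, 93, 147, 58]

/-- The circuits of the decagon. -/
def decL : List (Fin 2 → ℤ) :=
  [![1, -1], ![-1, 1], ![2, 1], ![-2, -1], ![1, 2], ![-1, -2], ![0, 1], ![0, -1], ![1, 0], ![-1, 0],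
    ![1, 1], ![-1, -1]]

lemma dec_start : castPt ![51, -12] ∈ (ofIneq decB decD).vertices :=
  mem_vertices_two (by decide +kernel) (by decide +kernel)

lemma dec_end : castPt ![-54, 39] ∈ (ofIneq decB decD).vertices :=
  mem_vertices_two (by decide +kernel) (by decide +kernel)

lemma dec_isCircuit : ∀ g, (ofIneq decB decD).IsCircuit g → g ∈ decL :=
  IsCircuit.mem_of_two dec_start (by decide +kernel)

lemma dec_isBounded : Bornology.IsBounded (ofIneq decB decD).carrier := by
  refine isBounded_of_abs_le 100 fun z hz => ?_
  have h := row_le_of_mem_carrier hz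
  simp [Fin.forall_fin_succ, decB, decD] at h ⊢
  constructor <;> rw [abs_le] <;> constructor <;> linarith

lemma dec_interior : (interior (ofIneq decB decD).carrier).Nonempty :=
  interior_nonempty_of_lt ![0, 0] (by decide +kernel)

/-- From `(51,-12)` to `(-54,39)` there is a maximal walk with the directions `(-1,-2)`, `(-1,1)`,
`(1,2)`; every maximal walk without opposite directions has at least four steps. -/
theorem strictlyBounds_fmb_fm : StrictlyBounds 2 {.f, .m, .b} {.f, .m} := by
  refine strictlyBounds_of_polyhedron (weaklyBounds_of_subset (by simp [Set.insert_subset_iff])) _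
    dec_isBounded dec_interior dec_start dec_end (a := 3) (b := 4) ?_ ?_ ?_
  · exact CD_le_two ![![51, -12], ![29, -56], ![-58, 31], ![-54, 39]]
      ![![-1, -2], ![-1, 1], ![1, 2]] ![22, 87, 4] (by decide +kernel) (by decide +kernel)
      (by rintro c (rfl | rfl) <;> decide +kernel)
  · exact le_CD_of_noWalk dec_isCircuit (by simp) (by simp) false true false (by simp) (by simp)
      (by simp) (by decide +kernel)
  · exact CD_le_two ![![51, -12], ![51, -3], ![0, 48], ![-54, -6], ![-54, 39]]
      ![![0, 1], ![-1, 1], ![-1, -1], ![0, 1]] ![9, 51, 54, 45]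
      (by decide +kernel) (by decide +kernel)
      (by rintro c (rfl | rfl | rfl) <;> decide +kernel)

/-! ### A polytope with ten facets in space -/

/-- The rows of a polytope with ten facets that is symmetric under the half-turn
`(x, y, z) ↦ (-x, y, -z)`. -/
def tenB : Matrix (Fin 10) (Fin 3) ℤ :=
  !![1, 1, 0; -1, 1, 0; 1, 2, 2; -1, 2, -2; 2, 0, -1; -2, 0, 1; 2, 1, 0; -2, 1, 0; 2, -1, -2;
    -2, -1, 2]

/-- The right-hand side of the polytope. -/
def tenD : Fin 10 → ℤ := ![0, 0, 0, 0, 40, 40, 26, 26, 60, 60]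

/-- One circuit of the polytope for each pair of opposite ones. -/
def tenHalf : List (Fin 3 → ℤ) :=
  [![0, 0, 1], ![2, -2, 1], ![-2, 2, 3], ![-1, 1, -2], ![-2, 2, -3], ![2, 2, -3], ![-2, -2,
    -1], ![-1, -1, -2], ![2, 2, 3], ![-2, 0, 1], ![-2, 5, -4], ![-2, 4, -3], ![-2, -4, 5],
    ![-2, 6, -5], ![-2, -5, -4], ![2, -4, -5], ![2, 4, 3], ![2, 6, 5], ![1, -2, 2], ![1, 2,
    2], ![1, -2, 0], ![-1, -2, 0], ![-1, 0, -1]]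

/-- The circuits of the polytope. -/
def tenL : List (Fin 3 → ℤ) := tenHalf ++ tenHalf.map fun g => -g

lemma ten_start : castPt ![26, -26, 12] ∈ (ofIneq tenB tenD).vertices :=
  mem_vertices_three (by decide +kernel) ⟨0, 4, 6, by decide +kernel⟩

lemma ten_end : castPt ![-26, -26, -12] ∈ (ofIneq tenB tenD).vertices :=
  mem_vertices_three (by decide +kernel) ⟨1, 5, 7, by decide +kernel⟩

lemma ten_isCircuit : ∀ g, (ofIneq tenB tenD).IsCircuit g → g ∈ tenL :=
  IsCircuit.mem_of_three ten_start (by decide +kernel)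

lemma ten_isBounded : Bornology.IsBounded (ofIneq tenB tenD).carrier := by
  refine isBounded_of_abs_le 100 fun z hz => ?_
  have h := row_le_of_mem_carrier hz
  simp [Fin.forall_fin_succ, Fin.sum_univ_succ, tenB, tenD] at h ⊢
  refine ⟨?_, ?_, ?_⟩ <;> rw [abs_le] <;> constructor <;> linarith

lemma ten_interior : (interior (ofIneq tenB tenD).carrier).Nonempty :=
  interior_nonempty_of_lt ![0, -1, 0] (by decide +kernel)

/-- From `(26,-26,12)` to `(-26,-26,-12)` there is an edge walk with four steps that starts and ends
with the direction `(0,0,1)`; non-repetitive edge walks have at least five steps. -/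
theorem strictlyBounds_efmr_efm : StrictlyBounds 3 {.e, .f, .m, .r} {.e, .f, .m} := by
  refine strictlyBounds_of_polyhedron (weaklyBounds_of_subset (by simp [Set.insert_subset_iff])) _
    ten_isBounded ten_interior ten_start ten_end (a := 4) (b := 5) ?_ ?_ ?_
  · exact CD_le_three
      ![![26, -26, 12], ![26, -26, 13], ![0, 0, 0], ![-26, -26, -13], ![-26, -26, -12]]
      ![![0, 0, 1], ![-2, 2, -1], ![-2, -2, -1], ![0, 0, 1]] ![1, 13, 13, 1]
      (by decide +kernel) (by decide +kernel) (by rintro c (rfl | rfl | rfl) <;> decide +kernel)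
  · exact le_CD_of_noWalk ten_isCircuit (by simp) (by simp) true false true (by simp) (by simp)
      (by simp) (by decide +kernel)
  · exact CD_le_three
      ![![26, -26, 12], ![26, -26, 13], ![0, 0, 0], ![-10, -10, 15], ![-20, -20, 0],
        ![-26, -26, -12]]
      ![![0, 0, 1], ![-2, 2, -1], ![-2, -2, 3], ![-2, -2, -3], ![-1, -1, -2]] ![1, 13, 5, 5, 6]
      (by decide +kernel) (by decide +kernel)
      (by rintro c (rfl | rfl | rfl | rfl) <;> decide +kernel)

/-! ### A parallelepiped and sign-compatible walks -/

/-- The rows of a parallelepiped in space whose facets at `(0,0,0)` are the coordinate planes. -/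
def boxB : Matrix (Fin 6) (Fin 3) ℤ :=
  !![-1, 0, 0; 0, -1, 0; 0, 0, -1; -1, 1, 1; 1, -1, 1; 1, 1, -1]

/-- The right-hand side of the parallelepiped. -/
def boxD : Fin 6 → ℤ := ![0, 0, 0, 1, 1, 1]

/-- One circuit of the parallelepiped for each pair of opposite ones. -/
def boxHalf : List (Fin 3 → ℤ) :=
  [![1, 0, 0], ![0, 1, 0], ![0, 0, 1], ![0, 1, 1], ![1, 0, 1], ![1, 1, 0], ![0, 1, -1],
    ![1, 0, -1], ![1, -1, 0]]

/-- The circuits of the parallelepiped. -/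
def boxL : List (Fin 3 → ℤ) := boxHalf ++ boxHalf.map fun g => -g

lemma box_start : castPt ![0, 0, 0] ∈ (ofIneq boxB boxD).vertices :=
  mem_vertices_three (by decide +kernel) ⟨0, 1, 2, by decide +kernel⟩

lemma box_end : castPt ![1, 1, 1] ∈ (ofIneq boxB boxD).vertices :=
  mem_vertices_three (by decide +kernel) ⟨3, 4, 5, by decide +kernel⟩

lemma box_isCircuit : ∀ g, (ofIneq boxB boxD).IsCircuit g → g ∈ boxL :=
  IsCircuit.mem_of_three box_start (by decide +kernel)

lemma box_isBounded : Bornology.IsBounded (ofIneq boxB boxD).carrier := by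
  refine isBounded_of_abs_le 1 fun z hz => ?_
  have h := row_le_of_mem_carrier hz
  simp [Fin.forall_fin_succ, Fin.sum_univ_succ, boxB, boxD] at h ⊢
  refine ⟨?_, ?_, ?_⟩ <;> rw [abs_le] <;> constructor <;> linarith

lemma box_interior : (interior (ofIneq boxB boxD).carrier).Nonempty :=
  interior_nonempty_of_lt ![1 / 2, 1 / 2, 1 / 2] (by decide +kernel)

/-- The circuits that are sign-compatible with the diagonal of the parallelepiped. -/
def boxDiag : Fin 3 → Fin 3 → ℤ := ![![0, 1, 1], ![1, 0, 1], ![1, 1, 0]]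

/-- Every sign-compatible walk along the diagonal contains each of the three circuits of
`boxDiag`, since the two others lie in a plane that does not contain the diagonal. -/
lemma three_le_box_length
    (W : (ofIneq boxB boxD).CircuitWalk (castPt ![0, 0, 0]) (castPt ![1, 1, 1]))
    (hs : W.Satisfies .s) : 3 ≤ W.length := by
  have hdir : ∀ i, ∃ a, W.dir i = boxDiag a := by
    intro i
    have hcompat : ∀ r, 0 ≤ (rowDir boxB r (W.dir i) : ℚ) *
        (rowVal boxB r ![1, 1, 1] - rowVal boxB r ![0, 0, 0]) := by
      intro r
      have h := hs.2 i r
      rw [ineqMap_toReal, ineqMap_sub, Pi.sub_apply, ineqMap_castPt, ineqMap_castPt] at h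
      exact_mod_cast h
    have hall : ∀ g ∈ boxL, (∀ r, 0 ≤ (rowDir boxB r g : ℚ) *
        (rowVal boxB r ![1, 1, 1] - rowVal boxB r ![0, 0, 0])) → ∃ a, g = boxDiag a := by
      decide +kernel
    exact hall _ (box_isCircuit _ (W.isCircuit_dir i)) hcompat
  have hsum : ∀ j : Fin 3, ∑ i, W.step i * (W.dir i j : ℝ) = 1 := by
    intro j
    have h := congrFun W.sum_step_smul j
    simp only [Finset.sum_apply, Pi.smul_apply, smul_eq_mul, toReal, Pi.sub_apply, castPt] at h
    rw [h]
    fin_cases j <;> simp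
  have hex : ∀ a : Fin 3, ∃ i, W.dir i = boxDiag a := by
    intro a
    by_contra! hno
    -- the coordinate `a` equals the sum of the two others on the remaining circuits
    have hplane : ∀ i, 2 * (W.dir i a : ℝ) = ∑ j, (W.dir i j : ℝ) := by
      intro i
      obtain ⟨c, hc⟩ := hdir i
      have hca : c ≠ a := fun h => hno i (h ▸ hc)
      have : ∀ c a : Fin 3, c ≠ a → 2 * boxDiag c a = ∑ j, boxDiag c j := by decide
      rw [hc]
      exact_mod_cast this c a hca
    have h1 : ∑ j : Fin 3, ∑ i, W.step i * (W.dir i j : ℝ) = 3 := by simp [hsum]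
    rw [Finset.sum_comm] at h1
    simp only [← Finset.mul_sum, ← hplane] at h1
    have h2 : ∑ i, W.step i * (2 * (W.dir i a : ℝ)) = 2 * 1 := by
      rw [← hsum a, Finset.mul_sum]
      exact Finset.sum_congr rfl fun i _ => by ring
    rw [h2] at h1
    norm_num at h1
  choose f hf using hex
  have hinj : Function.Injective f := by
    intro a b hab
    have h : boxDiag a = boxDiag b := by rw [← hf, ← hf, hab]
    have : Function.Injective boxDiag := by decide
    exact this h
  simpa using Fintype.card_le_of_injective f hinj

/-- From `(0,0,0)` to `(1,1,1)` the two steps `(1,0,0)` and `(0,1,1)` are feasible, but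
sign-compatible walks need three steps. -/
theorem strictlyBounds_fs_fbr : StrictlyBounds 3 {.f, .s} {.f, .b, .r} := by
  refine strictlyBounds_of_polyhedron weaklyBounds_signCompatible _
    box_isBounded box_interior box_start box_end (a := 2) (b := 3) ?_ ?_ ?_
  · exact CD_le_three ![![0, 0, 0], ![1, 0, 0], ![1, 1, 1]] ![![1, 0, 0], ![0, 1, 1]] ![1, 1]
      (by decide +kernel) (by decide +kernel) (by rintro c (rfl | rfl | rfl) <;> decide +kernel)
  · exact le_CD fun W hW => three_le_box_length W (hW .s (by simp))
  · exact CD_le_three ![![0, 0, 0], ![0, 1 / 2, 1 / 2], ![1 / 2, 1 / 2, 1], ![1, 1, 1]]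
      ![![0, 1, 1], ![1, 0, 1], ![1, 1, 0]] ![1 / 2, 1 / 2, 1 / 2]
      (by decide +kernel) (by decide +kernel) (by rintro c (rfl | rfl) <;> decide +kernel)

/-! ### Cubes with shrinking cross-section -/

section Frustum

variable {n m : ℕ}

/-- The vectors of the form `s e_i` with `i ≠ 0` or `s (e_0 - ∑_{i ∈ I} e_i)` with `0 ∉ I`. They
are the multiples of the circuits of `{0 ≤ z_0 ≤ 1, 0 ≤ z_i ≤ 2 - z_0}`. -/
def IsFrustumStep (x : Fin (n + 1) → ℝ) : Prop :=
  (x 0 = 0 → ∀ i j, i ≠ j → x i = 0 ∨ x j = 0) ∧ (x 0 ≠ 0 → ∀ i ≠ 0, x i = 0 ∨ x i = -x 0)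

/-- The rows of `{0 ≤ z_0 ≤ 1, 0 ≤ z_i ≤ 2 - z_0}`: multiples of `e_j`, and `e_0 + e_j` with
`j ≠ 0`. -/
def IsFrustumRow (B : Matrix (Fin m) (Fin (n + 1)) ℤ) (r : Fin m) : Prop :=
  (∃ j, B r j ≠ 0 ∧ ∀ i, i = j ∨ B r i = 0) ∨
    ∃ j, j ≠ 0 ∧ B r 0 = 1 ∧ B r j = 1 ∧ ∀ i, i = 0 ∨ i = j ∨ B r i = 0

instance (B : Matrix (Fin m) (Fin (n + 1)) ℤ) : DecidablePred (IsFrustumRow B) := fun r => by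
  unfold IsFrustumRow
  infer_instance

lemma IsFrustumStep.zero : IsFrustumStep (0 : Fin (n + 1) → ℝ) :=
  ⟨fun _ _ _ _ => Or.inl rfl, fun h => absurd rfl h⟩

lemma IsFrustumStep.smul {x : Fin (n + 1) → ℝ} (h : IsFrustumStep x) (c : ℝ) :
    IsFrustumStep (c • x) := by
  rcases eq_or_ne c 0 with rfl | hc
  · rw [zero_smul]
    exact IsFrustumStep.zero
  · simpa [IsFrustumStep, hc, ← mul_neg] using h

lemma IsCircuit.isFrustumStep {B : Matrix (Fin m) (Fin (n + 1)) ℤ} {d : Fin m → ℤ}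
    (hB : ∀ r, IsFrustumRow B r)
    {v : Fin (n + 1) → ℝ} (hv : v ∈ (ofIneq B d).vertices) {g : Fin (n + 1) → ℤ}
    (hg : (ofIneq B d).IsCircuit g) : IsFrustumStep (toReal g) := by
  -- no row orthogonal to `g` involves a coordinate `i` with `g i ≠ 0` and `g i ≠ -g 0`
  have key : ∀ i ≠ 0, g i ≠ 0 → g i ≠ -g 0 → ∃ c : ℝ, Pi.single i 1 = c • toReal g := by
    intro i hi hgi hgi0
    refine hg.exists_eq_smul hv (eqMap_ofIneq _ _) fun r hr => ?_
    rw [ineqMap_toReal] at hr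
    have hr' : ∑ j, B r j * g j = 0 := by exact_mod_cast hr
    have hri : B r i = 0 := by
      rcases hB r with ⟨j, hj, hother⟩ | ⟨j, hj0, h0, hj, hother⟩
      · rw [Finset.sum_eq_single j (fun k _ hk => by rw [(hother k).resolve_left hk, zero_mul])
          (by simp)] at hr'
        exact (hother i).resolve_left fun hij => hgi (hij ▸ (mul_eq_zero.1 hr').resolve_left hj)
      · refine ((hother i).resolve_left hi).resolve_left fun hij => hgi0 ?_
        rw [Finset.sum_eq_add (0 : Fin (n + 1)) j hj0.symm
          (fun k _ hk => by
            rw [((hother k).resolve_left hk.1).resolve_left hk.2, zero_mul])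
          (by simp) (by simp), h0, hj] at hr'
        rw [hij]
        omega
    rw [ineqMap_apply, Finset.sum_eq_single i (fun k _ hk => by simp [hk]) (by simp)]
    change (B r i : ℝ) * _ = 0
    rw [hri]
    simp
  constructor
  · intro h0 i j hij
    by_contra! h
    have hg0 : g 0 = 0 := by simpa [toReal] using h0
    have hgi : g i ≠ 0 := by simpa [toReal] using h.1
    obtain ⟨c, hc⟩ := key i (by rintro rfl; exact hgi hg0) hgi (by simpa [hg0] using hgi)
    have h1 := congrFun hc i
    have h2 := congrFun hc j
    simp only [Pi.single_eq_same, Pi.single_eq_of_ne hij.symm, Pi.smul_apply, smul_eq_mul] at h1 h2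
    rcases mul_eq_zero.1 h2.symm with rfl | h2
    · simp at h1
    · exact h.2 h2
  · intro h0 i hi
    by_contra! h
    have hgi : g i ≠ 0 := by simpa [toReal] using h.1
    have hgi0 : g i ≠ -g 0 := fun he => h.2 (by simp [toReal, he])
    obtain ⟨c, hc⟩ := key i hi hgi hgi0
    have h1 := congrFun hc i
    have h2 := congrFun hc 0
    simp only [Pi.single_eq_same, Pi.single_eq_of_ne hi.symm, Pi.smul_apply, smul_eq_mul] at h1 h2
    rcases mul_eq_zero.1 h2.symm with rfl | h2
    · simp at h1
    · exact h0 h2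

end Frustum

/-- The rows of `{0 ≤ t ≤ 1, 0 ≤ x, y ≤ 2 - t}`. -/
def fruB : Matrix (Fin 6) (Fin 3) ℤ :=
  !![-1, 0, 0; 0, -1, 0; 0, 0, -1; 1, 0, 0; 1, 1, 0; 1, 0, 1]

/-- The right-hand side of `{0 ≤ t ≤ 1, 0 ≤ x, y ≤ 2 - t}`. -/
def fruD : Fin 6 → ℤ := ![0, 0, 0, 1, 2, 2]

lemma fru_start : castPt ![0, 0, 0] ∈ (ofIneq fruB fruD).vertices :=
  mem_vertices_three (by decide +kernel) ⟨0, 1, 2, by decide +kernel⟩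

lemma fru_end : castPt ![1, 1, 1] ∈ (ofIneq fruB fruD).vertices :=
  mem_vertices_three (by decide +kernel) ⟨3, 4, 5, by decide +kernel⟩

lemma fru_bounds {z : Fin 3 → ℝ} (hz : z ∈ (ofIneq fruB fruD).carrier) :
    0 ≤ z 0 ∧ 0 ≤ z 1 ∧ 0 ≤ z 2 ∧ z 0 ≤ 1 ∧ z 0 + z 1 ≤ 2 ∧ z 0 + z 2 ≤ 2 := by
  have h := row_le_of_mem_carrier hz
  simpa [Fin.forall_fin_succ, Fin.sum_univ_succ, fruB, fruD] using h

lemma fru_isBounded : Bornology.IsBounded (ofIneq fruB fruD).carrier := by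
  refine isBounded_of_abs_le 2 fun z hz => ?_
  have h := fru_bounds hz
  simp [Fin.forall_fin_succ]
  refine ⟨?_, ?_, ?_⟩ <;> rw [abs_le] <;> constructor <;> linarith

lemma fru_interior : (interior (ofIneq fruB fruD).carrier).Nonempty :=
  interior_nonempty_of_lt ![1 / 2, 1 / 2, 1 / 2] (by decide +kernel)

lemma fru_no_two_steps {y : Fin 3 → ℝ} (hy : y ∈ (ofIneq fruB fruD).carrier)
    (h1 : IsFrustumStep y) (h2 : IsFrustumStep (castPt ![1, 1, 1] - y)) : False := by
  obtain ⟨b0, b1, b2, b3, -, -⟩ := fru_bounds hy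
  have e0 : (castPt ![1, 1, 1] - y) 0 = 1 - y 0 := by simp [castPt]
  have e1 : (castPt ![1, 1, 1] - y) 1 = 1 - y 1 := by simp [castPt]
  have e2 : (castPt ![1, 1, 1] - y) 2 = 1 - y 2 := by simp [castPt]
  have h1' := h1.1
  have h1'' := h1.2
  have h2' := h2.1
  have h2'' := h2.2
  rw [e0] at h2' h2''
  rcases eq_or_ne (y 0) 0 with h0 | h0
  · have h3 := h1' h0 1 2 (by decide)
    have h4 := h2'' (by rw [h0]; norm_num) 1 (by decide)
    have h5 := h2'' (by rw [h0]; norm_num) 2 (by decide)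
    rw [e1] at h4
    rw [e2] at h5
    rcases h3 with h3 | h3
    · rcases h4 with h4 | h4 <;> linarith
    · rcases h5 with h5 | h5 <;> linarith
  · have hpos := lt_of_le_of_ne b0 h0.symm
    have y1 : y 1 = 0 := (h1'' h0 1 (by decide)).elim id fun h => by linarith
    have y2 : y 2 = 0 := (h1'' h0 2 (by decide)).elim id fun h => by linarith
    rcases eq_or_ne (1 - y 0) 0 with h3 | h3
    · have := h2' h3 1 2 (by decide)
      rw [e1, e2, y1, y2] at this
      norm_num at this
    · have := h2'' h3 1 (by decide)
      rw [e1, y1] at this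
      rcases this with h | h <;> linarith

lemma three_le_fru_length
    (W : (ofIneq fruB fruD).CircuitWalk (castPt ![0, 0, 0]) (castPt ![1, 1, 1]))
    (hf : W.Satisfies .f) : 3 ≤ W.length := by
  have hstep : ∀ i : Fin W.length, IsFrustumStep (W.pt i.succ - W.pt i.castSucc) := fun i => by
    rw [W.pt_succ]
    exact ((W.isCircuit_dir i).isFrustumStep (by decide +kernel) fru_start).smul _
  have hv : castPt ![0, 0, 0] = (0 : Fin 3 → ℝ) := by
    funext j
    fin_cases j <;> simp [castPt]
  obtain ⟨k, pt, dir, step, h0, hl, hc, hs, hp⟩ := W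
  change ∀ i, pt i ∈ _ at hf
  change ∀ i : Fin k, IsFrustumStep (pt i.succ - pt i.castSucc) at hstep
  change 3 ≤ k
  by_contra! hk
  rw [hv] at h0
  interval_cases k
  · refine fru_no_two_steps (hf 0) (by rw [h0]; exact .zero) ?_
    rw [← hl]
    simpa using IsFrustumStep.zero
  · refine fru_no_two_steps (hf 1) ?_ ?_
    · simpa [h0] using hstep 0
    · rw [← hl]
      simpa using IsFrustumStep.zero
  · refine fru_no_two_steps (hf 1) ?_ ?_
    · simpa [h0] using hstep 0
    · rw [← hl]
      exact hstep 1

/-- From `(0,0,0)` to `(1,1,1)` the two steps `2 (1,0,0)` and `(-1,1,1)` leave the polytope, and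
feasible walks need three steps. -/
theorem strictlyBounds_f_soft : StrictlyBounds 3 {.f} ∅ := by
  refine strictlyBounds_of_polyhedron (weaklyBounds_of_subset (Set.empty_subset _)) _
    fru_isBounded fru_interior fru_start fru_end (a := 2) (b := 3) ?_ ?_ ?_
  · exact CD_le_three ![![0, 0, 0], ![2, 0, 0], ![1, 1, 1]] ![![1, 0, 0], ![-1, 1, 1]] ![2, 1]
      (by decide +kernel) (by decide +kernel) (by simp)
  · exact le_CD fun W hW => three_le_fru_length W (hW .f (by simp))
  · exact CD_le_three ![![0, 0, 0], ![1, 0, 0], ![1, 1, 0], ![1, 1, 1]]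
      ![![1, 0, 0], ![0, 1, 0], ![0, 0, 1]] ![1, 1, 1]
      (by decide +kernel) (by decide +kernel) (by rintro c rfl; decide +kernel)

/-- The rows of `{0 ≤ t ≤ 1, 0 ≤ x, y, z ≤ 2 - t}`. -/
def hfruB : Matrix (Fin 8) (Fin 4) ℤ :=
  !![-1, 0, 0, 0; 0, -1, 0, 0; 0, 0, -1, 0; 0, 0, 0, -1;
    1, 0, 0, 0; 1, 1, 0, 0; 1, 0, 1, 0; 1, 0, 0, 1]

/-- The right-hand side of `{0 ≤ t ≤ 1, 0 ≤ x, y, z ≤ 2 - t}`. -/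
def hfruD : Fin 8 → ℤ := ![0, 0, 0, 0, 1, 2, 2, 2]

lemma hfru_start : castPt ![0, 0, 0, 0] ∈ (ofIneq hfruB hfruD).vertices := by
  refine mem_vertices_of_tight (castPt_mem_carrier.2 (by decide +kernel)) fun z _ hz => ?_
  have h : ∀ r, rowVal hfruB r ![0, 0, 0, 0] = hfruD r → ∑ j, (hfruB r j : ℝ) * z j = 0 :=
    fun r hr => (ineqMap_apply _ _).symm.trans (hz r (ineqMap_castPt_eq_iff.2 hr))
  have h0 := h 0 (by decide +kernel)
  have h1 := h 1 (by decide +kernel)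
  have h2 := h 2 (by decide +kernel)
  have h3 := h 3 (by decide +kernel)
  simp [Fin.sum_univ_succ, hfruB] at h0 h1 h2 h3
  funext j
  fin_cases j <;> assumption

lemma hfru_end : castPt ![1, 1, 1, 1] ∈ (ofIneq hfruB hfruD).vertices := by
  refine mem_vertices_of_tight (castPt_mem_carrier.2 (by decide +kernel)) fun z _ hz => ?_
  have h : ∀ r, rowVal hfruB r ![1, 1, 1, 1] = hfruD r → ∑ j, (hfruB r j : ℝ) * z j = 0 :=
    fun r hr => (ineqMap_apply _ _).symm.trans (hz r (ineqMap_castPt_eq_iff.2 hr))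
  have h0 := h 4 (by decide +kernel)
  have h1 := h 5 (by decide +kernel)
  have h2 := h 6 (by decide +kernel)
  have h3 := h 7 (by decide +kernel)
  simp [Fin.sum_univ_succ, hfruB] at h0
  simp [Fin.sum_univ_succ, hfruB, h0] at h1 h2 h3
  funext j
  fin_cases j <;> assumption

lemma hfru_bounds {z : Fin 4 → ℝ} (hz : z ∈ (ofIneq hfruB hfruD).carrier) :
    0 ≤ z 0 ∧ 0 ≤ z 1 ∧ 0 ≤ z 2 ∧ 0 ≤ z 3 ∧ z 0 ≤ 1 ∧ z 0 + z 1 ≤ 2 ∧ z 0 + z 2 ≤ 2 ∧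
      z 0 + z 3 ≤ 2 := by
  have h := row_le_of_mem_carrier hz
  simpa [Fin.forall_fin_succ, Fin.sum_univ_succ, hfruB, hfruD] using h

lemma hfru_isBounded : Bornology.IsBounded (ofIneq hfruB hfruD).carrier := by
  refine isBounded_of_abs_le 2 fun z hz => ?_
  have h := hfru_bounds hz
  simp [Fin.forall_fin_succ]
  refine ⟨?_, ?_, ?_, ?_⟩ <;> rw [abs_le] <;> constructor <;> linarith

lemma hfru_interior : (interior (ofIneq hfruB hfruD).carrier).Nonempty :=
  interior_nonempty_of_lt ![1 / 2, 1 / 2, 1 / 2, 1 / 2] (by decide +kernel)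

/-- A coordinate vector is a circuit, as the other coordinates are rows. -/
lemma hfru_isCircuit_single (k : Fin 4) : (ofIneq hfruB hfruD).IsCircuit (Pi.single k 1) := by
  refine isCircuit_of_determinesLine (by revert k; decide +kernel) fun z hz => ⟨z k, ?_⟩
  have hrow : ∀ i : Fin 4, hfruB (Fin.castLE (by decide) i) = -Pi.single i 1 := by
    decide +kernel
  funext i
  rcases eq_or_ne i k with rfl | hik
  · simp [toReal]
  · have h := hz (Fin.castLE (by decide) i) (by simp [rowDir, hrow, Pi.single_apply, hik.symm])
    simp only [hrow] at h
    simpa [toReal, hik, Pi.single_apply] using h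

/-- The three upper facets that bound `x`, `y` and `z` meet in the line spanned by `(-1,1,1,1)`. -/
lemma hfru_isCircuit_diag : (ofIneq hfruB hfruD).IsCircuit ![-1, 1, 1, 1] := by
  refine isCircuit_of_determinesLine (by decide +kernel) fun z hz => ⟨-z 0, ?_⟩
  have h1 := hz 5 (by decide +kernel)
  have h2 := hz 6 (by decide +kernel)
  have h3 := hz 7 (by decide +kernel)
  simp [Fin.sum_univ_succ, hfruB] at h1 h2 h3
  funext j
  fin_cases j <;> simp [toReal] <;> linarith

/-- A feasible walk with three steps from `(0,0,0,0)` to `(1,1,1,1)` starts and ends with the step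
`(1,0,0,0)`. -/
lemma hfru_three_steps {y u : Fin 4 → ℝ} (hy : y ∈ (ofIneq hfruB hfruD).carrier)
    (hu : u ∈ (ofIneq hfruB hfruD).carrier) (h1 : IsFrustumStep y) (h2 : IsFrustumStep (u - y))
    (h3 : IsFrustumStep (castPt ![1, 1, 1, 1] - u)) :
    y = toReal ![1, 0, 0, 0] ∧ castPt ![1, 1, 1, 1] - u = toReal ![1, 0, 0, 0] := by
  obtain ⟨by0, by1, by2, by3, by0', -⟩ := hfru_bounds hy
  obtain ⟨bu0, bu1, bu2, bu3, bu0', -⟩ := hfru_bounds hu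
  have hsub : ∀ i, (castPt ![1, 1, 1, 1] - u) i = 1 - u i := fun i => by
    fin_cases i <;> simp [castPt]
  obtain ⟨p1, q1⟩ := h1
  obtain ⟨p2, q2⟩ := h2
  obtain ⟨p3, q3⟩ := h3
  simp only [hsub] at p3 q3
  simp only [Pi.sub_apply] at p2 q2
  -- of `x`, `y` and `z`, two are zero in each step that keeps `t`
  have two : ∀ f : Fin 4 → ℝ, (∀ i j, i ≠ j → f i = 0 ∨ f j = 0) →
      (f 1 = 0 ∧ f 2 = 0) ∨ (f 1 = 0 ∧ f 3 = 0) ∨ (f 2 = 0 ∧ f 3 = 0) := by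
    intro f hf
    have h12 := hf 1 2 (by decide)
    have h13 := hf 1 3 (by decide)
    have h23 := hf 2 3 (by decide)
    tauto
  have hz : u 0 ≠ 1 → 1 ≤ u 1 ∧ 1 ≤ u 2 ∧ 1 ≤ u 3 := by
    intro hne
    have hne' : 1 - u 0 ≠ 0 := fun h => hne (by linarith)
    refine ⟨?_, ?_, ?_⟩
    · rcases q3 hne' 1 (by decide) with h | h <;> linarith
    · rcases q3 hne' 2 (by decide) with h | h <;> linarith
    · rcases q3 hne' 3 (by decide) with h | h <;> linarith
  rcases eq_or_ne (y 0) 0 with hy0 | hy0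
  · exfalso
    have hy' := two y (p1 hy0)
    rcases eq_or_ne (u 0) 1 with hu0 | hu0
    · have hu' := two (fun i => 1 - u i) (p3 (by rw [hu0, sub_self]))
      have hx : u 0 - y 0 ≠ 0 := by rw [hu0, hy0]; norm_num
      -- `x`, `y` and `z` do not increase in the second step
      have hle : ∀ i ≠ 0, u i ≤ y i := fun i hi => by
        rcases q2 hx i hi with h | h <;> linarith
      have l1 := hle 1 (by decide)
      have l2 := hle 2 (by decide)
      have l3 := hle 3 (by decide)
      rcases hy' with h | h | h <;> rcases hu' with h' | h' | h' <;> linarith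
    · obtain ⟨g1, g2, g3⟩ := hz hu0
      rcases eq_or_ne (u 0 - y 0) 0 with hx | hx
      · have hx' := two (fun i => u i - y i) (p2 hx)
        rcases hy' with h | h | h <;> rcases hx' with h' | h' | h' <;> linarith
      · have hle : ∀ i ≠ 0, u i ≤ y i := fun i hi => by
          rcases q2 hx i hi with h | h <;> linarith
        have l1 := hle 1 (by decide)
        have l2 := hle 2 (by decide)
        have l3 := hle 3 (by decide)
        rcases hy' with h | h | h <;> linarith
  · have hy1 : y 1 = 0 := (q1 hy0 1 (by decide)).elim id fun h => by linarith
    have hy2 : y 2 = 0 := (q1 hy0 2 (by decide)).elim id fun h => by linarith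
    have hy3 : y 3 = 0 := (q1 hy0 3 (by decide)).elim id fun h => by linarith
    have hypos : 0 < y 0 := lt_of_le_of_ne by0 hy0.symm
    rcases eq_or_ne (u 0) 1 with hu0 | hu0
    · exfalso
      have hu' := two (fun i => 1 - u i) (p3 (by rw [hu0, sub_self]))
      rcases eq_or_ne (u 0 - y 0) 0 with hx | hx
      · have hx' := two (fun i => u i - y i) (p2 hx)
        rcases hu' with h | h | h <;> rcases hx' with h' | h' | h' <;> linarith
      · have hle : ∀ i ≠ 0, u i ≤ y i := fun i hi => by
          rcases q2 hx i hi with h | h <;> linarith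
        have l1 := hle 1 (by decide)
        have l2 := hle 2 (by decide)
        have l3 := hle 3 (by decide)
        rcases hu' with h | h | h <;> linarith
    · obtain ⟨g1, g2, g3⟩ := hz hu0
      have hx : u 0 - y 0 ≠ 0 := fun hx => by
        have hx' := two (fun i => u i - y i) (p2 hx)
        rcases hx' with h' | h' | h' <;> linarith
      have e1 : u 1 = y 0 - u 0 := by
        rcases q2 hx 1 (by decide) with h | h <;> linarith
      have e2 : u 2 = y 0 - u 0 := by
        rcases q2 hx 2 (by decide) with h | h <;> linarith
      have e3 : u 3 = y 0 - u 0 := by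
        rcases q2 hx 3 (by decide) with h | h <;> linarith
      have e : y 0 = 1 := by linarith
      have e' : u 0 = 0 := by linarith
      constructor
      · funext j
        fin_cases j <;> simp [toReal, e, hy1, hy2, hy3]
      · funext j
        rw [hsub]
        fin_cases j <;> simp [toReal, e', e1, e2, e3, e]

lemma eq_of_smul_eq {n : ℕ} {g h : Fin n → ℤ} (hg : Finset.univ.gcd g = 1)
    (hh : Finset.univ.gcd h = 1) {s : ℝ} (hs : 0 < s) (h' : s • toReal g = toReal h) : g = h := by
  rcases eq_or_eq_neg_of_parallel hh hg h'.symm with h1 | h1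
  · exact h1.symm
  · obtain ⟨i, hi⟩ := Function.ne_iff.1 (ne_zero_of_gcd_eq_one hg)
    have h2 := congrFun h' i
    have hi' : (g i : ℝ) ≠ 0 := by exact_mod_cast hi
    simp only [Pi.smul_apply, smul_eq_mul, toReal, h1, Pi.neg_apply, Int.cast_neg] at h2
    have h3 : (s + 1) * (g i : ℝ) = 0 := by linarith
    exact absurd ((mul_eq_zero.1 h3).resolve_right hi') (by positivity)

lemma four_le_hfru_length
    (W : (ofIneq hfruB hfruD).CircuitWalk (castPt ![0, 0, 0, 0]) (castPt ![1, 1, 1, 1]))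
    (hf : W.Satisfies .f) (hr : W.Satisfies .r) : 4 ≤ W.length := by
  have hstep : ∀ i : Fin W.length, IsFrustumStep (W.pt i.succ - W.pt i.castSucc) := fun i => by
    rw [W.pt_succ]
    exact ((W.isCircuit_dir i).isFrustumStep (by decide +kernel) hfru_start).smul _
  have hv : castPt ![0, 0, 0, 0] = (0 : Fin 4 → ℝ) := by
    funext j
    fin_cases j <;> simp [castPt]
  obtain ⟨k, pt, dir, step, h0, hl, hc, hs, hp⟩ := W
  change ∀ i, pt i ∈ _ at hf
  change ∀ i j : Fin k, i ≠ j → dir i ≠ dir j at hr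
  change ∀ i : Fin k, IsFrustumStep (pt i.succ - pt i.castSucc) at hstep
  change 4 ≤ k
  by_contra! hk
  rw [hv] at h0
  have hlast : ∀ {x : Fin 4 → ℝ}, castPt ![1, 1, 1, 1] - x = toReal ![1, 0, 0, 0] →
      x ≠ castPt ![1, 1, 1, 1] := by
    rintro x hx rfl
    have := congrFun hx 0
    simp [toReal] at this
  -- shorter walks are filled up with zero steps
  interval_cases k
  · refine hlast (hfru_three_steps (hf 0) (hf 0) ?_ ?_ ?_).2 hl
    · rw [h0]; exact .zero
    · rw [sub_self]; exact .zero
    · rw [← hl, show Fin.last 0 = 0 from rfl, sub_self]; exact .zero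
  · refine hlast (hfru_three_steps (hf 1) (hf 1) ?_ ?_ ?_).2 hl
    · simpa [h0] using hstep 0
    · rw [sub_self]; exact .zero
    · rw [← hl]
      simpa using IsFrustumStep.zero
  · refine hlast (hfru_three_steps (hf 1) (hf 2) ?_ ?_ ?_).2 hl
    · simpa [h0] using hstep 0
    · exact hstep 1
    · rw [← hl]
      simpa using IsFrustumStep.zero
  · obtain ⟨e1, e2⟩ := hfru_three_steps (hf 1) (hf 2) (by simpa [h0] using hstep 0) (hstep 1)
      (by rw [← hl]; exact hstep 2)
    have hp0 : pt 1 - pt 0 = step 0 • toReal (dir 0) := hp 0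
    have hp2 : pt (Fin.last 3) - pt 2 = step 2 • toReal (dir 2) := hp 2
    rw [h0, sub_zero, e1] at hp0
    rw [hl, e2] at hp2
    have hgcd : Finset.univ.gcd (![1, 0, 0, 0] : Fin 4 → ℤ) = 1 := by decide +kernel
    refine hr 0 2 (by decide) ?_
    rw [eq_of_smul_eq (hc 0).2.2.1 hgcd (hs 0) hp0.symm,
      eq_of_smul_eq (hc 2).2.2.1 hgcd (hs 2) hp2.symm]

/-- From `(0,0,0,0)` to `(1,1,1,1)` there are feasible walks with three steps, but they contain
the step `(1,0,0,0)` twice; non-repetitive walks need four steps. -/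
theorem strictlyBounds_repetitive {R S : Set Restriction} (hSR : S ⊆ R) (hf : .f ∈ R)
    (hr : .r ∈ R) (hR : R ⊆ {.f, .b, .r}) (hS : S ⊆ {.f, .b}) : StrictlyBounds 4 R S := by
  have hT : IsLineTest hfruB fun _ _ => false := fun _ _ _ h => absurd h Bool.false_ne_true
  refine strictlyBounds_of_polyhedron (weaklyBounds_of_subset hSR) _
    hfru_isBounded hfru_interior hfru_start hfru_end (a := 3) (b := 4) ?_ ?_ ?_
  · refine CD_le_of_walkCriterion hT
      ![![0, 0, 0, 0], ![1, 0, 0, 0], ![0, 1, 1, 1], ![1, 1, 1, 1]]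
      ![Pi.single 0 1, ![-1, 1, 1, 1], Pi.single 0 1] ![1, 1, 1] ?_ (by decide +kernel)
      fun c hc => ?_
    · intro i
      fin_cases i
      exacts [hfru_isCircuit_single 0, hfru_isCircuit_diag, hfru_isCircuit_single 0]
    · rcases hS hc with rfl | rfl <;> decide +kernel
  · exact le_CD fun W hW => four_le_hfru_length W (hW _ hf) (hW _ hr)
  · refine CD_le_of_walkCriterion hT
      ![![0, 0, 0, 0], ![1, 0, 0, 0], ![1, 1, 0, 0], ![1, 1, 1, 0], ![1, 1, 1, 1]]
      (fun i => Pi.single i 1) ![1, 1, 1, 1] hfru_isCircuit_single (by decide +kernel)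
      fun c hc => ?_
    rcases hR hc with rfl | rfl | rfl <;> decide +kernel

end Polyhedron

/-! ### Comparison of the circuit distances -/

theorem theorem1 :
    -- edge walks
    StrictlyBounds 2 {.e, .f, .m, .b} {.e, .f, .m} ∧
    StrictlyBounds 3 {.e, .f, .m, .r} {.e, .f, .m} ∧
    -- edge walks versus feasible maximal walks
    StrictlyBounds 2 {.e, .f, .m, .b} {.f, .m, .b} ∧
    StrictlyBounds 2 {.e, .f, .m} {.f, .m} ∧
    StrictlyBounds 2 {.e, .f, .m, .r} {.f, .m, .r} ∧
    -- feasible maximal walks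
    StrictlyBounds 2 {.f, .m, .b} {.f, .m} ∧
    StrictlyBounds 2 {.f, .m, .r} {.f, .m} ∧
    -- feasible maximal walks versus feasible walks
    StrictlyBounds 2 {.f, .m, .b} {.f, .b} ∧
    StrictlyBounds 2 {.f, .m} {.f} ∧
    StrictlyBounds 2 {.f, .m, .r} {.f, .r} ∧
    -- feasible walks
    WeaklyBounds {.f, .b} {.f} ∧
    StrictlyBounds 4 {.f, .r} {.f} ∧
    StrictlyBounds 4 {.f, .b, .r} {.f, .b} ∧
    WeaklyBounds {.f, .b, .r} {.f, .r} ∧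
    -- feasible sign-compatible walks
    StrictlyBounds 3 {.f, .s} {.f, .b, .r} ∧
    -- soft walks
    StrictlyBounds 3 {.f} ∅ := by
  refine ⟨Polyhedron.strictlyBounds_efmb_efm, Polyhedron.strictlyBounds_efmr_efm,
    Polyhedron.strictlyBounds_edge ?_ ?_ ?_ ?_ ?_ ?_,
    Polyhedron.strictlyBounds_edge ?_ ?_ ?_ ?_ ?_ ?_,
    Polyhedron.strictlyBounds_edge ?_ ?_ ?_ ?_ ?_ ?_,
    Polyhedron.strictlyBounds_fmb_fm, Polyhedron.strictlyBounds_fmr_fm,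
    Polyhedron.strictlyBounds_maximal ?_ ?_ ?_ ?_ ?_ ?_,
    Polyhedron.strictlyBounds_maximal ?_ ?_ ?_ ?_ ?_ ?_,
    Polyhedron.strictlyBounds_maximal ?_ ?_ ?_ ?_ ?_ ?_,
    weaklyBounds_of_subset ?_,
    Polyhedron.strictlyBounds_repetitive ?_ ?_ ?_ ?_ ?_,
    Polyhedron.strictlyBounds_repetitive ?_ ?_ ?_ ?_ ?_,
    weaklyBounds_of_subset ?_, Polyhedron.strictlyBounds_fs_fbr,
    Polyhedron.strictlyBounds_f_soft⟩ <;> simp [Set.insert_subset_iff]
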